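/- All graphs are finite and simple, except where a new edge is added in (iv) below. A snark is a (connected) bridgeless cubic graph that is cyclically $4$-edge-connected (deleting fewer than four edges never leaves two components each containing a cycle), has edge chromatic number four, and has girth at least five. A $2$-factor of a graph is a $2$-regular spanning subgraph; it is odd if all its cycles have odd length. A graph is odd $2$-factored if all its $2$-factors are odd. An edge $xy$ of a snark $L$ is a bold-edge if (i) all $2$-factors of $L-x$ and of $L-y$ are odd; (ii) all $2$-factors of $L$ containing $xy$ are odd; (iii) all $2$-factors of $L$ avoiding $xy$ are odd. Two independent edges $f=ab$, $g=cd$ of a snark $R$ form a gadget-pair if (i) no $2$-factor of $R$ avoids both $f$ and $g$; (ii) all $2$-factors of $R$ containing exactly one of $f,g$ are odd; (iii) all $2$-factors of $R$ containing both $f$ and $g$ are odd, and $f,g$ lie in different cycles of each such $2$-factor; (iv) in every $2$-factor of $(R-\{f,g\})\cup\{ac,ad,bc,bd\}$ containing exactly one of the four new edges $ac,ad,bc,bd$, the cycle containing the new edge has even length and all other cycles have odd length (here a new edge is distinct from the edges of $R$; if its ends are already adjacent in $R$ it is a parallel edge, and two parallel edges form a cycle of length two). For an edge $xy$ of $L$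 with $N(x)\setminus\{y\}=\{r,s\}$ and $N(y)\setminus\{x\}=\{t,u\}$, and independent edges $ab,cd$ of $R$, the dot product $L\cdot R$ is obtained from the disjoint union of $L-\{x,y\}$ and $R-\{ab,cd\}$ by adding two edges that match $\{r,s\}$ with one of $\{a,b\},\{c,d\}$ and two edges that match $\{t,u\}$ with the other; any of the resulting graphs is allowed. **Theorem 3.1.** Let $xy$ be a bold-edge in a snark $L$ and let $\{ab,cd\}$ be a gadget-pair in a snark $R$. Then every dot product $L\cdot R$ built from these edges is a snark and is odd $2$-factored: every cycle of every $2$-factor of $L\cdot R$ has odd length. -/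

import Mathlib

namespace BoldGadget

/-- `F` is a `2`-factor of `G`: a spanning subgraph in which every vertex has degree two. -/
def IsTwoFactor {V : Type*} (G F : SimpleGraph V) : Prop :=
  F ≤ G ∧ ∀ v, (F.neighborSet v).ncard = 2

/-- Every cycle of `F` has odd length (for a `2`-factor: `F` is odd). -/
def IsOdd {V : Type*} (F : SimpleGraph V) : Prop :=
  ∀ (v : V) (C : F.Walk v v), C.IsCycle → Odd C.length

/-- Every cycle of every `2`-factor of `G` is odd. -/
def IsOddTwoFactored {V : Type*} (G : SimpleGraph V) : Prop :=
  ∀ F, IsTwoFactor G F → IsOdd F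

/-- `G` is cyclically `k`-edge-connected: deleting fewer than `k` edges never leaves two
components that both contain a cycle. -/
def IsCyclicallyEdgeConnected {V : Type*} (G : SimpleGraph V) (k : ℕ) : Prop :=
  ∀ S : Set (Sym2 V), S ⊆ G.edgeSet → S.encard < k →
    ∀ (u v : V) (C : (G.deleteEdges S).Walk u u) (D : (G.deleteEdges S).Walk v v),
      C.IsCycle → D.IsCycle → (G.deleteEdges S).Reachable u v

/-- A snark: a connected bridgeless cubic graph, cyclically `4`-edge-connected, with edge
chromatic number four and girth at least five. It is used for finite graphs only. -/
structure IsSnark {V : Type*} (G : SimpleGraph V) : Prop where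
  connected : G.Connected
  cubic : ∀ v, (G.neighborSet v).ncard = 3
  bridgeless : ∀ e ∈ G.edgeSet, ¬ G.IsBridge e
  cyclically_four_edge_connected : IsCyclicallyEdgeConnected G 4
  edge_chromatic_number : G.lineGraph.chromaticNumber = 4
  girth : 5 ≤ G.egirth

/-- The edge `xy` is a bold-edge of `L`. The graph `L - v` is the induced subgraph
`L.induce {v}ᶜ`. -/
structure IsBoldEdge {V : Type*} (L : SimpleGraph V) (x y : V) : Prop where
  adj : L.Adj x y
  odd_delete_left : ∀ F, IsTwoFactor (L.induce {x}ᶜ) F → IsOdd F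
  odd_delete_right : ∀ F, IsTwoFactor (L.induce {y}ᶜ) F → IsOdd F
  odd_containing : ∀ F, IsTwoFactor L F → F.Adj x y → IsOdd F
  odd_avoiding : ∀ F, IsTwoFactor L F → ¬ F.Adj x y → IsOdd F

/-- `H` together with one *new* edge `pq` is a `2`-factor of the (multi)graph obtained from `G` by
adding new edges. The new edge is not an edge of `G`, even when `p` and `q` are already
adjacent in `G` (it is then a parallel edge). Here `H` is the set of the edges of the `2`-factor
that belong to `G`, so `p` and `q` have degree one in `H` and the new edge raises it to two. -/
def IsTwoFactorWithNewEdge {V : Type*} (G H : SimpleGraph V) (p q : V) : Prop :=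
  H ≤ G ∧ (H.neighborSet p).ncard = 1 ∧ (H.neighborSet q).ncard = 1 ∧
    ∀ v, v ≠ p → v ≠ q → (H.neighborSet v).ncard = 2

/-- The edges `f = ab` and `g = cd` form a gadget-pair of `R`.

In the last two conditions `H` together with a new edge `pq`, where `pq` is one of
`ac, ad, bc, bd`, is a `2`-factor of `(R - {f, g}) ∪ {ac, ad, bc, bd}` which contains exactly one
of the four new edges. Its cycle through the new edge consists of the new edge and a
path of `H` from `p` to `q`, and its other cycles are the cycles of `H`. -/
structure IsGadgetPair {V : Type*} (R : SimpleGraph V) (a b c d : V) : Prop where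
  adj_left : R.Adj a b
  adj_right : R.Adj c d
  independent : a ≠ c ∧ a ≠ d ∧ b ≠ c ∧ b ≠ d
  not_avoiding : ¬ ∃ F, IsTwoFactor R F ∧ ¬ F.Adj a b ∧ ¬ F.Adj c d
  odd_one : ∀ F, IsTwoFactor R F →
    (F.Adj a b ∧ ¬ F.Adj c d ∨ ¬ F.Adj a b ∧ F.Adj c d) → IsOdd F
  odd_both : ∀ F, IsTwoFactor R F → F.Adj a b → F.Adj c d → IsOdd F
  different_cycles : ∀ F, IsTwoFactor R F → F.Adj a b → F.Adj c d →
    ∀ (v : V) (C : F.Walk v v), C.IsCycle → ¬ (s(a, b) ∈ C.edges ∧ s(c, d) ∈ C.edges)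
  even_new : ∀ p q, (p = a ∨ p = b) → (q = c ∨ q = d) →
    ∀ H, IsTwoFactorWithNewEdge (R.deleteEdges {s(a, b), s(c, d)}) H p q →
      ∀ P : H.Walk p q, P.IsPath → Even (P.length + 1)
  odd_old : ∀ p q, (p = a ∨ p = b) → (q = c ∨ q = d) →
    ∀ H, IsTwoFactorWithNewEdge (R.deleteEdges {s(a, b), s(c, d)}) H p q → IsOdd H

/-- The four new edges `ra, sb, tc, ud` of the dot product. -/
def joiningEdges {V W : Type*} (x y r s t u : V) (a b c d : W) :
    SimpleGraph (({x, y}ᶜ : Set V) ⊕ W) :=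
  SimpleGraph.fromRel fun m n => ∃ (v : ({x, y}ᶜ : Set V)) (w : W), m = Sum.inl v ∧ n = Sum.inr w ∧
    ((v : V) = r ∧ w = a ∨ (v : V) = s ∧ w = b ∨ (v : V) = t ∧ w = c ∨ (v : V) = u ∧ w = d)

/-- The dot product `L · R`: remove from `L` the adjacent vertices `x` and `y`, whose other
neighbours are `r, s` and `t, u` respectively, remove from `R` the edges `ab` and `cd`,
and join `r` to `a`, `s` to `b`, `t` to `c` and `u` to `d`. All the ways to join
`{r, s}` and `{t, u}` to `{a, b}` and `{c, d}` arise by renaming `r, s, t, u, a, b, c, d`. -/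
def dotProduct {V W : Type*} (L : SimpleGraph V) (x y r s t u : V)
    (R : SimpleGraph W) (a b c d : W) : SimpleGraph (({x, y}ᶜ : Set V) ⊕ W) :=
  ((L.induce {x, y}ᶜ).sum (R.deleteEdges {s(a, b), s(c, d)})) ⊔ joiningEdges x y r s t u a b c d

end BoldGadget

/-!
A cubic graph without nontrivial edge cuts of size at most three is connected, bridgeless and
cyclically `4`-edge-connected. If it also has girth at least five, then its line graph is
`4`-colourable, by Lovász's greedy proof of Brooks' theorem. If it is moreover odd `2`-factored,
then it has no `3`-edge-colouring, since two of the three colour classes would form an even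
`2`-factor. So the dot product is a snark as soon as its small cuts, its short cycles and its
`2`-factors are under control.

A `2`-factor of `L · R` contains an even number of the four joining edges. Its trace on `L - {x, y}`
is completed by edges at `x` and `y`, and its trace on `R - {ab, cd}` by `ab`, `cd` or a new edge
between them; the bold-edge and the gadget-pair give the parities of the cycles of these
completions. Replacing the added edges by the joining edges recovers the `2`-factor of `L · R`, and
only the sizes of the cycles through the added edges have to be combined.
-/

namespace BoldGadget

open SimpleGraph

section Valency

variable {U U' : Type*}

/-- The degree of a vertex, as a cardinality that needs no decidability or finiteness instance. -/
noncomputable def valency (G : SimpleGraph U) (v : U) : ℕ := (G.neighborSet v).ncard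

open Classical in
/-- The indicator function of the vertex `p`, for the bookkeeping of degrees. -/
noncomputable def delta (p v : U) : ℕ := if v = p then 1 else 0

theorem delta_map {f : U → U'} (hf : f.Injective) (p v : U) : delta (f p) (f v) = delta p v := by
  simp only [delta]
  congr 1
  exact propext hf.eq_iff

theorem degree_eq_valency (G : SimpleGraph U) (v : U) [Fintype (G.neighborSet v)] :
    G.degree v = valency G v := by
  rw [valency, Set.ncard_eq_toFinset_card', ← neighborFinset_def, card_neighborFinset_eq_degree]

theorem valency_map (f : U ↪ U') (G : SimpleGraph U) (v : U) :
    valency (G.map f) (f v) = valency G v := by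
  have h : (G.map f).neighborSet (f v) = f '' G.neighborSet v := by
    ext z
    simp only [mem_neighborSet, map_adj, f.injective.eq_iff, Set.mem_image]
    grind
  rw [valency, h, Set.ncard_image_of_injective _ f.injective, valency]

theorem valency_map_of_notMem_range {f : U ↪ U'} {G : SimpleGraph U} {z : U'}
    (hz : z ∉ Set.range f) : valency (G.map f) z = 0 := by
  have h : (G.map f).neighborSet z = ∅ := by
    rw [Set.eq_empty_iff_forall_notMem]
    rintro w ⟨_, v, w, _, hv, _⟩
    exact hz ⟨v, hv⟩
  rw [valency, h, Set.ncard_empty]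

theorem valency_sum_inl (G : SimpleGraph U) (H : SimpleGraph U') (v : U) :
    valency (G ⊕g H) (.inl v) = valency G v := by
  rw [valency, neighborSet_sum_inl, Set.ncard_image_of_injective _ Sum.inl_injective, valency]

theorem valency_sum_inr (G : SimpleGraph U) (H : SimpleGraph U') (v : U') :
    valency (G ⊕g H) (.inr v) = valency H v := by
  rw [valency, neighborSet_sum_inr, Set.ncard_image_of_injective _ Sum.inr_injective, valency]

variable [Finite U]

theorem valency_eq_zero_iff {G : SimpleGraph U} {v : U} :
    valency G v = 0 ↔ ∀ w, ¬ G.Adj v w := by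
  rw [valency, Set.ncard_eq_zero, Set.eq_empty_iff_forall_notMem]
  rfl

theorem valency_sup_edge {G : SimpleGraph U} {p q : U} (hpq : p ≠ q) (h : ¬ G.Adj p q) (v : U) :
    valency (G ⊔ edge p q) v = valency G v + delta p v + delta q v := by
  have key {p q : U} (hpq : p ≠ q) (h : ¬ G.Adj p q) :
      valency (G ⊔ edge p q) p = valency G p + 1 := by
    have hset : (G ⊔ edge p q).neighborSet p = insert q (G.neighborSet p) := by
      ext w
      simp only [mem_neighborSet, sup_adj, edge_adj, Set.mem_insert_iff]
      grind
    rw [valency, hset, Set.ncard_insert_of_notMem (show q ∉ G.neighborSet p from h), valency]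
  by_cases hp : v = p
  · subst hp
    simp [key hpq h, delta, hpq]
  by_cases hq : v = q
  · subst hq
    rw [edge_comm, key hpq.symm fun h' => h h'.symm]
    simp [delta, hp]
  · have hset : (G ⊔ edge p q).neighborSet v = G.neighborSet v := by
      ext w
      simp [edge_adj, hp, hq]
    simp [valency, hset, delta, hp, hq]

end Valency

section Cut

variable {U U' : Type*}

/-- The edges of `G` that leave `A`, directed away from `A`. -/
def cut (G : SimpleGraph U) (A : Set U) : Set (U × U) :=
  {z | z.1 ∈ A ∧ z.2 ∉ A ∧ G.Adj z.1 z.2}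

/-- The number of edges between `A` and its complement. -/
noncomputable def cutSize (G : SimpleGraph U) (A : Set U) : ℕ := (cut G A).ncard

open Classical in
/-- The contribution to an edge cut of an edge with ends `p` and `q`, where `P` and `Q` say whether
`p` and `q` lie on the first side of the cut. -/
noncomputable def crossing (P Q : Prop) : ℕ := if (P ↔ Q) then 0 else 1

theorem cutSize_compl (G : SimpleGraph U) (A : Set U) : cutSize G Aᶜ = cutSize G A := by
  have h : cut G Aᶜ = Prod.swap '' cut G A := by
    ext ⟨v, w⟩
    simp [cut, adj_comm, and_left_comm]
  rw [cutSize, h, Set.ncard_image_of_injective _ Prod.swap_injective, cutSize]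

theorem cutSize_singleton (G : SimpleGraph U) (v : U) : cutSize G {v} = valency G v := by
  have h : cut G {v} = Prod.mk v '' G.neighborSet v := by
    ext ⟨u, w⟩
    simp only [cut, Set.mem_ofPred_eq, Set.mem_singleton_iff, Set.mem_image, mem_neighborSet,
      Prod.mk.injEq]
    grind [SimpleGraph.Adj.ne]
  rw [cutSize, h, Set.ncard_image_of_injective _ (Prod.mk_right_injective v), valency]

theorem cutSize_eq_zero_of_closed {G : SimpleGraph U} {A : Set U}
    (hA : ∀ v ∈ A, ∀ w, G.Adj v w → w ∈ A) : cutSize G A = 0 := by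
  have h : cut G A = ∅ :=
    Set.eq_empty_iff_forall_notMem.2 fun z ⟨hz₁, hz₂, hz⟩ => hz₂ (hA _ hz₁ _ hz)
  rw [cutSize, h, Set.ncard_empty]

theorem cutSize_map (f : U ↪ U') (G : SimpleGraph U) (A : Set U') :
    cutSize (G.map f) A = cutSize G (f ⁻¹' A) := by
  have h : cut (G.map f) A = Prod.map f f '' cut G (f ⁻¹' A) := by
    ext ⟨v, w⟩
    simp only [cut, map_adj, Set.mem_ofPred_eq, Set.mem_image, Set.mem_preimage, Prod.exists,
      Prod.map_apply, Prod.mk.injEq]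
    grind
  rw [cutSize, h, Set.ncard_image_of_injective _ (f.injective.prodMap f.injective), cutSize]

variable [Finite U] [Finite U']

theorem cutSize_sum (G : SimpleGraph U) (H : SimpleGraph U') (A : Set (U ⊕ U')) :
    cutSize (G ⊕g H) A = cutSize G (Sum.inl ⁻¹' A) + cutSize H (Sum.inr ⁻¹' A) := by
  have h : cut (G ⊕g H) A = Prod.map .inl .inl '' cut G (Sum.inl ⁻¹' A) ∪
      Prod.map .inr .inr '' cut H (Sum.inr ⁻¹' A) := by
    ext ⟨v | v, w | w⟩ <;> simp [cut]
  rw [cutSize, h, Set.ncard_union_eq _ (Set.toFinite _) (Set.toFinite _),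
    Set.ncard_image_of_injective _ (Sum.inl_injective.prodMap Sum.inl_injective),
    Set.ncard_image_of_injective _ (Sum.inr_injective.prodMap Sum.inr_injective), cutSize, cutSize]
  rw [Set.disjoint_left]
  rintro _ ⟨z, _, rfl⟩ ⟨z', _, h⟩
  simp [Prod.map] at h

theorem cutSize_sup_edge {G : SimpleGraph U} {p q : U} (h : ¬ G.Adj p q) (A : Set U) :
    cutSize (G ⊔ edge p q) A = cutSize G A + crossing (p ∈ A) (q ∈ A) := by
  have key {p q : U} (h : ¬ G.Adj p q) (hp : p ∈ A) (hq : q ∉ A) :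
      cutSize (G ⊔ edge p q) A = cutSize G A + 1 := by
    have hset : cut (G ⊔ edge p q) A = insert (p, q) (cut G A) := by
      ext ⟨v, w⟩
      simp only [cut, sup_adj, edge_adj, Set.mem_ofPred_eq, Set.mem_insert_iff, Prod.mk.injEq]
      grind
    rw [cutSize, hset, Set.ncard_insert_of_notMem fun hz => h hz.2.2, cutSize]
  by_cases hpq : p ∈ A ↔ q ∈ A
  · have hset : cut (G ⊔ edge p q) A = cut G A := by
      ext ⟨v, w⟩
      simp only [cut, sup_adj, edge_adj, Set.mem_ofPred_eq]
      grind
    rw [cutSize, hset, crossing, if_pos hpq, cutSize, add_zero]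
  rw [crossing, if_neg hpq]
  by_cases hp : p ∈ A
  · exact key h hp fun hq => hpq (iff_of_true hp hq)
  · rw [edge_comm]
    exact key (fun h' => h h'.symm) (by_contra fun hq => hpq (iff_of_false hp hq)) hp

theorem sum_valency (G : SimpleGraph U) (A : Set U) [Fintype A] :
    ∑ v : A, valency G v = 2 * (G.induce A).edgeSet.ncard + cutSize G A := by
  classical
  have hinner : ∑ v : A, (G.neighborSet v ∩ A).ncard = 2 * (G.induce A).edgeSet.ncard := by
    rw [Set.ncard_eq_toFinset_card', ← edgeFinset, ← sum_degrees_eq_twice_card_edges]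
    refine Finset.sum_congr rfl fun v _ => ?_
    rw [degree_eq_valency, valency, ← Set.ncard_image_of_injective _ Subtype.val_injective]
    congr 1
    ext w
    simp [and_comm]
  have houter : ∑ v : A, (G.neighborSet v \ A).ncard = cutSize G A := by
    let e : cut G A ≃ Σ v : A, (G.neighborSet v \ A : Set U) :=
      { toFun z := ⟨⟨z.1.1, z.2.1⟩, z.1.2, z.2.2.2, z.2.2.1⟩
        invFun z := ⟨(z.1, z.2), z.1.2, z.2.2.2, z.2.2.1⟩
        left_inv _ := rfl
        right_inv _ := rfl }
    rw [cutSize, ← Nat.card_coe_set_eq, Nat.card_congr e, Nat.card_sigma]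
    simp only [Nat.card_coe_set_eq]
  rw [← hinner, ← houter, ← Finset.sum_add_distrib]
  exact Finset.sum_congr rfl fun v _ =>
    (Set.ncard_inter_add_ncard_sdiff_eq_ncard _ _ (Set.toFinite _)).symm

theorem even_ncard_odd_valency_add_cutSize (G : SimpleGraph U) (A : Set U) :
    Even ({v ∈ A | Odd (valency G v)}.ncard + cutSize G A) := by
  classical
  have := Fintype.ofFinite A
  have hcard : {v ∈ A | Odd (valency G v)}.ncard =
      (Finset.univ.filter fun v : A => Odd (valency G v)).card := by
    rw [← Set.ncard_coe_finset, ← Set.ncard_image_of_injective _ Subtype.val_injective]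
    congr 1
    ext v
    simp [and_comm]
  have hsum := Finset.even_sum_iff_even_card_odd (s := Finset.univ) fun v : A => valency G v
  rw [sum_valency, Nat.even_add, iff_true_left (even_two_mul _)] at hsum
  rw [hcard, Nat.even_add, hsum]

theorem not_isAcyclic_induce {G : SimpleGraph U} {A : Set U} (hne : A.Nonempty) {n : ℕ}
    (hn : ∀ v ∈ A, n ≤ valency G v) (hlt : 2 * A.ncard + cutSize G A < n * A.ncard + 2) :
    ¬ (G.induce A).IsAcyclic := by
  classical
  have := Fintype.ofFinite U
  have := hne.to_subtype
  intro hA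
  obtain ⟨T, hle, -, hT⟩ := (connected_top (V := A)).exists_isTree_le_of_le_of_isAcyclic le_top hA
  have hcard : Fintype.card A = A.ncard := by
    rw [← Nat.card_eq_fintype_card, Nat.card_coe_set_eq]
  have hedges : (G.induce A).edgeSet.ncard + 1 ≤ A.ncard := by
    rw [← hcard, ← hT.card_edgeFinset, Set.ncard_eq_toFinset_card', ← edgeFinset]
    exact Nat.add_le_add_right (Finset.card_le_card (edgeFinset_mono hle)) 1
  have hsum : n * A.ncard ≤ ∑ v : A, valency G v := by
    rw [← hcard, mul_comm, ← smul_eq_mul, ← Finset.card_univ]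
    exact Finset.card_nsmul_le_sum _ _ _ fun v _ => hn v v.2
  rw [sum_valency] at hsum
  omega

end Cut

section Component

variable {U U' : Type*}

/-- The number of vertices of the component of `v`. -/
noncomputable def compCard (K : SimpleGraph U) (v : U) : ℕ := {w | K.Reachable v w}.ncard

theorem mem_of_reachable {K : SimpleGraph U} {S : Set U}
    (hS : ∀ v ∈ S, ∀ w, K.Adj v w → w ∈ S) {v w : U} (hv : v ∈ S) (h : K.Reachable v w) :
    w ∈ S := by
  obtain ⟨p⟩ := h
  induction p with
  | nil => exact hv
  | cons h _ ih => exact ih (hS _ hv _ h)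

theorem cutSize_reachable {M K : SimpleGraph U} (hle : M ≤ K) (v : U) :
    cutSize M {w | K.Reachable v w} = 0 :=
  cutSize_eq_zero_of_closed fun _ hw _ hz => hw.trans (hle hz).reachable

theorem reachable_iff_of_le {H K : SimpleGraph U} (hle : H ≤ K) {v : U}
    (h : ∀ w z, H.Reachable v w → K.Adj w z → H.Reachable v z) (w : U) :
    K.Reachable v w ↔ H.Reachable v w :=
  ⟨mem_of_reachable (S := {w | H.Reachable v w}) (fun _ hw _ hz => h _ _ hw hz) .rfl,
    fun hw => hw.mono hle⟩

theorem compCard_congr {K : SimpleGraph U} {v w : U} (h : K.Reachable v w) :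
    compCard K v = compCard K w := by
  unfold compCard
  congr 1
  ext z
  exact ⟨h.symm.trans, h.trans⟩

theorem compCard_eq_of_le {H K : SimpleGraph U} (hle : H ≤ K) {v : U}
    (h : ∀ w z, H.Reachable v w → K.Adj w z → H.Reachable v z) :
    compCard K v = compCard H v := by
  simp only [compCard, reachable_iff_of_le hle h]

theorem eq_of_reachable_of_forall_not_adj {K : SimpleGraph U} {v w : U}
    (hv : ∀ z, ¬ K.Adj v z) (h : K.Reachable v w) : w = v :=
  mem_of_reachable (S := {v}) (by rintro _ rfl z hz; exact (hv z hz).elim) rfl h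

theorem compCard_eq_one {K : SimpleGraph U} {v : U} (hv : ∀ z, ¬ K.Adj v z) :
    compCard K v = 1 := by
  rw [compCard, Set.ncard_eq_one]
  exact ⟨v, Set.eq_singleton_iff_unique_mem.2
    ⟨.rfl, fun _ hw => eq_of_reachable_of_forall_not_adj hv hw⟩⟩

theorem compCard_sup_edge_of_reachable {K : SimpleGraph U} {p q : U} (h : K.Reachable p q) (v : U) :
    compCard (K ⊔ edge p q) v = compCard K v := by
  refine compCard_eq_of_le le_sup_left fun w z hw hz => ?_
  rw [sup_adj, edge_adj] at hz
  rcases hz with hz | ⟨⟨rfl, rfl⟩ | ⟨rfl, rfl⟩, -⟩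
  exacts [hw.trans hz.reachable, hw.trans h, hw.trans h.symm]

theorem compCard_sup_edge_of_not_reachable {K : SimpleGraph U} {p q v : U}
    (hp : ¬ K.Reachable v p) (hq : ¬ K.Reachable v q) :
    compCard (K ⊔ edge p q) v = compCard K v := by
  refine compCard_eq_of_le le_sup_left fun w z hw hz => ?_
  rw [sup_adj, edge_adj] at hz
  rcases hz with hz | ⟨⟨rfl, rfl⟩ | ⟨rfl, rfl⟩, -⟩
  exacts [hw.trans hz.reachable, (hp hw).elim, (hq hw).elim]

theorem reachable_sum_inl {G : SimpleGraph U} {H : SimpleGraph U'} {v : U} {z : U ⊕ U'} :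
    (G ⊕g H).Reachable (.inl v) z ↔ ∃ w, G.Reachable v w ∧ z = .inl w := by
  constructor
  · refine mem_of_reachable (S := {z | ∃ w, G.Reachable v w ∧ z = Sum.inl w}) ?_ ⟨v, .rfl, rfl⟩
    rintro _ ⟨w, hw, rfl⟩ (z | z) hz
    · exact ⟨z, hw.trans (Adj.reachable (by simpa using hz)), rfl⟩
    · simp at hz
  · rintro ⟨w, hw, rfl⟩
    exact hw.map (Embedding.sumInl (G := G) (H := H)).toHom

theorem reachable_sum_inr {G : SimpleGraph U} {H : SimpleGraph U'} {v : U'} {z : U ⊕ U'} :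
    (G ⊕g H).Reachable (.inr v) z ↔ ∃ w, H.Reachable v w ∧ z = .inr w := by
  constructor
  · refine mem_of_reachable (S := {z | ∃ w, H.Reachable v w ∧ z = Sum.inr w}) ?_ ⟨v, .rfl, rfl⟩
    rintro _ ⟨w, hw, rfl⟩ (z | z) hz
    · simp at hz
    · exact ⟨z, hw.trans (Adj.reachable (by simpa using hz)), rfl⟩
  · rintro ⟨w, hw, rfl⟩
    exact hw.map (Embedding.sumInr (G := G) (H := H)).toHom

theorem compCard_sum_inl (G : SimpleGraph U) (H : SimpleGraph U') (v : U) :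
    compCard (G ⊕g H) (.inl v) = compCard G v := by
  have h : {z | (G ⊕g H).Reachable (.inl v) z} = Sum.inl '' {w | G.Reachable v w} := by
    ext z
    simp [reachable_sum_inl, eq_comm]
  rw [compCard, h, Set.ncard_image_of_injective _ Sum.inl_injective, compCard]

theorem compCard_sum_inr (G : SimpleGraph U) (H : SimpleGraph U') (v : U') :
    compCard (G ⊕g H) (.inr v) = compCard H v := by
  have h : {z | (G ⊕g H).Reachable (.inr v) z} = Sum.inr '' {w | H.Reachable v w} := by
    ext z
    simp [reachable_sum_inr, eq_comm]
  rw [compCard, h, Set.ncard_image_of_injective _ Sum.inr_injective, compCard]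

theorem compCard_map (f : U ↪ U') (K : SimpleGraph U) (v : U) :
    compCard (K.map f) (f v) = compCard K v := by
  have h : {z | (K.map f).Reachable (f v) z} = f '' {w | K.Reachable v w} := by
    refine Set.Subset.antisymm (fun z hz => ?_) ?_
    · refine mem_of_reachable (S := f '' {w | K.Reachable v w}) ?_ ⟨v, .rfl, rfl⟩ hz
      rintro _ ⟨w, hw, rfl⟩ z hz
      obtain ⟨w', z', hwz, hw', rfl⟩ := hz.2
      obtain rfl := f.injective hw'
      exact ⟨z', Reachable.trans hw hwz.reachable, rfl⟩
    · rintro _ ⟨w, hw, rfl⟩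
      exact hw.map (Embedding.map f K).toHom
  rw [compCard, h, Set.ncard_image_of_injective _ f.injective, compCard]

theorem valency_le_of_isCycle {K : SimpleGraph U} {v : U} {C : K.Walk v v}
    (hC : C.IsCycle) {w : U} (hw : w ∈ C.support) (h2 : valency K w = 2) :
    valency K w ≤ (C.toSubgraph.neighborSet w).ncard := by
  rw [hC.ncard_neighborSet_toSubgraph_eq_two hw, h2]

variable [Finite U]

theorem exists_odd_valency_reachable {K : SimpleGraph U} {p : U} (hp : Odd (valency K p)) :
    ∃ q, q ≠ p ∧ K.Reachable p q ∧ Odd (valency K q) := by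
  have heven := even_ncard_odd_valency_add_cutSize K {w | K.Reachable p w}
  rw [cutSize_reachable le_rfl, add_zero] at heven
  have hmem : p ∈ {v ∈ {w | K.Reachable p w} | Odd (valency K v)} := ⟨.rfl, hp⟩
  have hpos := (Set.ncard_pos).2 ⟨p, hmem⟩
  obtain ⟨k, hk⟩ := heven
  obtain ⟨q, ⟨hr, hq⟩, hne⟩ := Set.exists_ne_of_one_lt_ncard
    (show 1 < {v ∈ {w | K.Reachable p w} | Odd (valency K v)}.ncard by omega) p
  exact ⟨q, hne, hr, hq⟩

theorem even_compCard_of_valency_eq_one {M K : SimpleGraph U} (hle : M ≤ K)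
    (hM : ∀ v, valency M v = 1) (v : U) : Even (compCard K v) := by
  simpa [hM, cutSize_reachable hle, compCard] using
    even_ncard_odd_valency_add_cutSize M {w | K.Reachable v w}

theorem mem_edges_of_adj {K : SimpleGraph U} {u v : U} {P : K.Walk u v} {w z : U}
    (hP : valency K w ≤ (P.toSubgraph.neighborSet w).ncard) (hz : K.Adj w z) :
    s(w, z) ∈ P.edges := by
  have h : P.toSubgraph.neighborSet w = K.neighborSet w :=
    Set.eq_of_subset_of_ncard_le (P.toSubgraph.neighborSet_subset w) hP (Set.toFinite _)
  have hmem : z ∈ P.toSubgraph.neighborSet w := h ▸ hz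
  rwa [Subgraph.mem_neighborSet, Walk.adj_toSubgraph_iff_mem_edges] at hmem

theorem reachable_iff_mem_support {K : SimpleGraph U} {u v : U} {P : K.Walk u v}
    (hP : ∀ w ∈ P.support, valency K w ≤ (P.toSubgraph.neighborSet w).ncard) (w : U) :
    K.Reachable u w ↔ w ∈ P.support := by
  classical
  refine ⟨fun h => ?_, fun h => ⟨P.takeUntil w h⟩⟩
  exact mem_of_reachable (S := {w | w ∈ P.support})
    (fun a ha b hb => P.snd_mem_support_of_mem_edges (mem_edges_of_adj (hP a ha) hb))
    P.start_mem_support h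

theorem compCard_eq_length {K : SimpleGraph U} {v : U} {C : K.Walk v v} (hC : C.IsCycle)
    (h2 : ∀ w ∈ C.support, valency K w = 2) : compCard K v = C.length := by
  classical
  have h : {w | K.Reachable v w} = (C.support.tail.toFinset : Set U) := by
    ext w
    rw [Set.mem_ofPred_eq,
      reachable_iff_mem_support fun w hw => valency_le_of_isCycle hC hw (h2 w hw),
      Walk.mem_support_iff, List.coe_toFinset, Set.mem_ofPred_eq, or_iff_right_of_imp]
    rintro rfl
    exact Walk.end_mem_tail_support hC.not_nil
  rw [compCard, h, Set.ncard_coe_finset, List.toFinset_card_of_nodup hC.support_nodup,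
    List.length_tail, Walk.length_support, Nat.add_sub_cancel]

theorem exists_isCycle_of_valency_eq_two {K : SimpleGraph U} {v : U}
    (h : ∀ w, K.Reachable v w → valency K w = 2) :
    ∃ u, K.Reachable v u ∧ ∃ C : K.Walk u u, C.IsCycle := by
  have hcyc := not_isAcyclic_induce (G := K) (A := {w | K.Reachable v w}) ⟨v, .rfl⟩
    (fun w hw => (h w hw).ge) (by rw [cutSize_reachable le_rfl]; omega)
  simp only [IsAcyclic, not_forall, not_not] at hcyc
  obtain ⟨u, C, hC⟩ := hcyc
  exact ⟨u.1, u.2, C.map (Embedding.induce _).toHom, hC.map Subtype.val_injective⟩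

theorem IsOdd.odd_compCard {K : SimpleGraph U} (hK : IsOdd K) {v : U}
    (h : ∀ w, K.Reachable v w → valency K w = 2) : Odd (compCard K v) := by
  classical
  obtain ⟨u, hu, C, hC⟩ := exists_isCycle_of_valency_eq_two h
  rw [compCard_congr hu,
    compCard_eq_length hC fun w hw => h w (hu.trans (C.takeUntil w hw).reachable)]
  exact hK u C hC

theorem isOdd_of_odd_compCard {K : SimpleGraph U} (h2 : ∀ v, valency K v = 2)
    (hodd : ∀ v, Odd (compCard K v)) : IsOdd K := by
  intro v C hC
  rw [← compCard_eq_length hC fun w _ => h2 w]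
  exact hodd v

theorem compCard_eq_length_add_one {K : SimpleGraph U} {p q : U} {P : K.Walk p q}
    (hP : P.IsPath) (hpq : p ≠ q) (hp : valency K p = 1) (hq : valency K q = 1)
    (h2 : ∀ w, w ≠ p → w ≠ q → valency K w = 2) : compCard K p = P.length + 1 := by
  classical
  have hn : ¬ P.Nil := fun h => hpq h.eq
  have hval : ∀ w ∈ P.support, valency K w ≤ (P.toSubgraph.neighborSet w).ncard := by
    intro w hw
    by_cases hwp : w = p
    · rw [hwp, hP.neighborSet_toSubgraph_startpoint hn, Set.ncard_singleton, hp]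
    by_cases hwq : w = q
    · rw [hwq, hP.neighborSet_toSubgraph_endpoint hn, Set.ncard_singleton, hq]
    obtain ⟨i, rfl, hi⟩ := Walk.mem_support_iff_exists_getVert.1 hw
    rw [h2 _ hwp hwq, hP.ncard_neighborSet_toSubgraph_internal_eq_two (by rintro rfl; simp at hwp)
      (lt_of_le_of_ne hi (by rintro rfl; simp at hwq))]
  have h : {w | K.Reachable p w} = (P.support.toFinset : Set U) := by
    ext w
    rw [Set.mem_ofPred_eq, reachable_iff_mem_support hval, List.coe_toFinset, Set.mem_ofPred_eq]
  rw [compCard, h, Set.ncard_coe_finset, List.toFinset_card_of_nodup hP.support_nodup,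
    Walk.length_support]

end Component

section Reroute

variable {U : Type*}

theorem compCard_sup_edge_sup_edge [Finite U] {B : SimpleGraph U} {p q r s v : U}
    (hpq : B.Reachable p q) (hpr : ¬ B.Reachable p r) (hps : ¬ B.Reachable p s)
    (hv : B.Reachable r v ∨ B.Reachable s v ∨ B.Reachable p v) :
    compCard (B ⊔ edge r p ⊔ edge s q) v =
      {w | B.Reachable r w ∨ B.Reachable s w}.ncard + compCard B p := by
  set K := B ⊔ edge r p ⊔ edge s q
  have hle : B ≤ K := le_sup_left.trans le_sup_left
  have hrp' : r ≠ p := by rintro rfl; exact hpr .rfl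
  have hsq' : s ≠ q := by rintro rfl; exact hps hpq
  have hpr' : K.Reachable p r := Adj.reachable (by simp [K, edge_adj, hrp'.symm])
  have hps' : K.Reachable p s :=
    (hpq.mono hle).trans (Adj.reachable (by simp [K, edge_adj, hsq'.symm]))
  have hset : {w | K.Reachable p w} =
      {w | B.Reachable r w ∨ B.Reachable s w} ∪ {w | B.Reachable p w} := by
    refine Set.Subset.antisymm (fun w => mem_of_reachable ?_ (.inr .rfl)) ?_
    · intro w hw z hz
      simp only [K, sup_adj, edge_adj] at hz
      rcases hz with (hz | ⟨⟨rfl, rfl⟩ | ⟨rfl, rfl⟩, -⟩) | ⟨⟨rfl, rfl⟩ | ⟨rfl, rfl⟩, -⟩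
      · exact hw.imp (Or.imp (·.trans hz.reachable) (·.trans hz.reachable))
          (·.trans hz.reachable)
      exacts [.inr .rfl, .inl (.inl .rfl), .inr hpq, .inl (.inr .rfl)]
    · rintro w ((hw | hw) | hw)
      exacts [hpr'.trans (hw.mono hle), hps'.trans (hw.mono hle), hw.mono hle]
  have hdisj : Disjoint {w | B.Reachable r w ∨ B.Reachable s w} {w | B.Reachable p w} := by
    rw [Set.disjoint_left]
    rintro w (hw | hw) hpw
    exacts [hpr (hpw.trans hw.symm), hps (hpw.trans hw.symm)]
  have hpv : K.Reachable p v := by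
    rcases hv with hv | hv | hv
    exacts [hpr'.trans (hv.mono hle), hps'.trans (hv.mono hle), hv.mono hle]
  rw [← compCard_congr hpv, compCard, hset, Set.ncard_union_eq hdisj, compCard]

theorem compCard_sup_edge_sup_edge_of_not_reachable {B : SimpleGraph U} {p q r s v : U}
    (hpq : B.Reachable p q) (hrv : ¬ B.Reachable r v) (hsv : ¬ B.Reachable s v)
    (hpv : ¬ B.Reachable p v) : compCard (B ⊔ edge r p ⊔ edge s q) v = compCard B v := by
  refine compCard_eq_of_le (le_sup_left.trans le_sup_left) fun w z hw hz => ?_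
  simp only [sup_adj, edge_adj] at hz
  rcases hz with (hz | ⟨⟨rfl, rfl⟩ | ⟨rfl, rfl⟩, -⟩) | ⟨⟨rfl, rfl⟩ | ⟨rfl, rfl⟩, -⟩
  exacts [hw.trans hz.reachable, (hrv hw.symm).elim, (hpv hw.symm).elim, (hsv hw.symm).elim,
    (hpv (hpq.trans hw.symm)).elim]

-- In the cycle through `r` and `s`, a path from `p` to `q` is exchanged for a path from `a` to `b`
-- with a vertex count of the same parity.
theorem odd_compCard_reroute [Finite U] {B : SimpleGraph U} {S : Set U} {p q r s a b : U}
    (hpq : B.Reachable p q) (hab : B.Reachable a b) (hpS : ∀ v, B.Reachable p v → v ∈ S)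
    (hrS : r ∉ S) (hsS : s ∉ S) (har : ¬ B.Reachable a r) (has : ¬ B.Reachable a s)
    (hcard : Odd (compCard B p) ↔ Odd (compCard B a))
    (hodd : ∀ v ∉ S, ¬ B.Reachable a v → Odd (compCard (B ⊔ edge r p ⊔ edge s q) v)) :
    ∀ v ∉ S, Odd (compCard (B ⊔ edge r a ⊔ edge s b) v) := by
  intro v hv
  have hpr : ¬ B.Reachable p r := fun h => hrS (hpS r h)
  have hps : ¬ B.Reachable p s := fun h => hsS (hpS s h)
  by_cases hva : B.Reachable r v ∨ B.Reachable s v ∨ B.Reachable a v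
  · rw [compCard_sup_edge_sup_edge hab har has hva, Nat.odd_add', ← hcard, ← Nat.odd_add',
      ← compCard_sup_edge_sup_edge hpq hpr hps (.inl .rfl)]
    exact hodd r hrS har
  · push Not at hva
    obtain ⟨hrv, hsv, hav⟩ := hva
    rw [compCard_sup_edge_sup_edge_of_not_reachable hab hrv hsv hav,
      ← compCard_sup_edge_sup_edge_of_not_reachable hpq hrv hsv fun h => hv (hpS v h)]
    exact hodd v hv hav

theorem odd_compCard_reroute_of_isolated [Finite U] {B : SimpleGraph U} {S : Set U} {p r s a b : U}
    (hp : ∀ z, ¬ B.Adj p z) (hpS : p ∈ S) (hab : B.Reachable a b) (hrS : r ∉ S) (hsS : s ∉ S)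
    (har : ¬ B.Reachable a r) (has : ¬ B.Reachable a s) (ha : Odd (compCard B a))
    (hodd : ∀ v ∉ S, ¬ B.Reachable a v → Odd (compCard (B ⊔ edge r p ⊔ edge s p) v)) :
    ∀ v ∉ S, Odd (compCard (B ⊔ edge r a ⊔ edge s b) v) := by
  refine odd_compCard_reroute .rfl hab (fun v hv => ?_) hrS hsS har has ?_ hodd
  · rwa [eq_of_reachable_of_forall_not_adj hp hv]
  · rw [compCard_eq_one hp]
    exact iff_of_true odd_one ha

end Reroute

section ThreeCuts

variable {V : Type*}

/-- An edge cut with at most three edges isolates at most one vertex. For a cubic graph this is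
another form of cyclic `4`-edge-connectedness, without mention of cycles. -/
def HasOnlyTrivialThreeCuts (G : SimpleGraph V) : Prop :=
  ∀ A : Set V, A.Nontrivial → Aᶜ.Nontrivial → 4 ≤ cutSize G A

theorem deleteEdges_cut_adj {G : SimpleGraph V} {A : Set V} {v w : V} :
    (G.deleteEdges ((fun z => s(z.1, z.2)) '' cut G A)).Adj v w ↔ G.Adj v w ∧ (v ∈ A ↔ w ∈ A) := by
  simp only [deleteEdges_adj, Set.mem_image, cut, Set.mem_ofPred_eq, Prod.exists, Sym2.eq_iff]
  grind [SimpleGraph.Adj.symm]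

variable {G : SimpleGraph V}

theorem HasOnlyTrivialThreeCuts.three_le_cutSize (hG : HasOnlyTrivialThreeCuts G)
    (h3 : ∀ v, valency G v = 3) {A : Set V} (hA : A.Nonempty) (hA' : Aᶜ.Nonempty) :
    3 ≤ cutSize G A := by
  obtain ⟨v, rfl⟩ | hA := hA.exists_eq_singleton_or_nontrivial
  · rw [cutSize_singleton, h3]
  obtain ⟨v, hv⟩ | hA' := hA'.exists_eq_singleton_or_nontrivial
  · rw [← cutSize_compl, hv, cutSize_singleton, h3]
  · exact le_trans (by norm_num) (hG A hA hA')

variable [Finite V]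

theorem IsSnark.hasOnlyTrivialThreeCuts (hG : IsSnark G) : HasOnlyTrivialThreeCuts G := by
  intro A hA hA'
  by_contra! hlt
  set S := (fun z : V × V => s(z.1, z.2)) '' cut G A
  have hcycle (B : Set V) (hB : B.Nontrivial) (hcut : cutSize G B = cutSize G A)
      (hBA : ∀ v ∈ B, ∀ w ∈ B, (v ∈ A ↔ w ∈ A)) :
      ∃ v ∈ B, ∃ C : (G.deleteEdges S).Walk v v, C.IsCycle := by
    have hcard := Set.one_lt_ncard_iff_nontrivial.2 hB
    have hcyc := not_isAcyclic_induce hB.nonempty (fun v _ => (hG.cubic v).ge)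
      (show 2 * B.ncard + cutSize G B < 3 * B.ncard + 2 by omega)
    simp only [IsAcyclic, not_forall, not_not] at hcyc
    obtain ⟨v, C, hC⟩ := hcyc
    let f : G.induce B →g G.deleteEdges S :=
      ⟨Subtype.val, fun {p q} h => deleteEdges_cut_adj.2 ⟨h, hBA p p.2 q q.2⟩⟩
    exact ⟨v, v.2, C.map f, hC.map Subtype.val_injective⟩
  obtain ⟨v, hv, C, hC⟩ := hcycle A hA rfl fun v hv w hw => iff_of_true hv hw
  obtain ⟨w, hw, D, hD⟩ :=
    hcycle Aᶜ hA' (cutSize_compl G A) fun v hv w hw => iff_of_false hv hw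
  have hSG : S ⊆ G.edgeSet := by
    rintro _ ⟨z, hz, rfl⟩
    exact hz.2.2
  have hS : S.encard < 4 := by
    refine (Set.encard_image_le _ _).trans_lt ?_
    rw [← Set.Finite.cast_ncard_eq (Set.toFinite _)]
    exact_mod_cast hlt
  exact hw (mem_of_reachable (fun v hv w h => (deleteEdges_cut_adj.1 h).2.1 hv) hv
    (hG.cyclically_four_edge_connected S hSG hS v w C D hC hD))

theorem cutSize_reachable_deleteEdges_le (S : Set (Sym2 V)) (v : V) :
    cutSize G {w | (G.deleteEdges S).Reachable v w} ≤ S.ncard := by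
  refine Set.ncard_le_ncard_of_injOn (fun z => s(z.1, z.2)) ?_ ?_ (Set.toFinite _)
  · rintro ⟨p, q⟩ ⟨hp, hq, hpq⟩
    by_contra hS
    exact hq (Reachable.trans hp (Adj.reachable (deleteEdges_adj.2 ⟨hpq, hS⟩)))
  · rintro ⟨p, q⟩ ⟨hp, -, -⟩ ⟨p', q'⟩ ⟨-, hq', -⟩ h
    grind [Sym2.eq_iff]

namespace HasOnlyTrivialThreeCuts

theorem reachable_deleteEdges (hG : HasOnlyTrivialThreeCuts G) (h3 : ∀ v, valency G v = 3)
    {S : Set (Sym2 V)} (hS : S.ncard ≤ 2) (v w : V) : (G.deleteEdges S).Reachable v w := by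
  by_contra h
  have hcut := hG.three_le_cutSize h3 (A := {w | (G.deleteEdges S).Reachable v w}) ⟨v, .rfl⟩ ⟨w, h⟩
  have hle := cutSize_reachable_deleteEdges_le (G := G) S v
  omega

theorem connected (hG : HasOnlyTrivialThreeCuts G) (h3 : ∀ v, valency G v = 3) [Nonempty V] :
    G.Connected where
  preconnected v w := (hG.reachable_deleteEdges h3 (S := ∅) (by simp) v w).mono (deleteEdges_le _)

theorem not_isBridge (hG : HasOnlyTrivialThreeCuts G) (h3 : ∀ v, valency G v = 3) (e : Sym2 V) :
    ¬ G.IsBridge e := by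
  induction e with
  | h v w =>
    rw [isBridge_iff, not_not]
    exact hG.reachable_deleteEdges h3 (by simp) v w

theorem isCyclicallyEdgeConnected (hG : HasOnlyTrivialThreeCuts G) :
    IsCyclicallyEdgeConnected G 4 := by
  intro S _ hS v w C D hC hD
  have hS' : S.ncard < 4 := by
    rw [← Set.Finite.cast_ncard_eq (Set.toFinite _)] at hS
    exact_mod_cast hS
  by_contra h
  have hnontrivial {v : V} {C : (G.deleteEdges S).Walk v v} (hC : C.IsCycle) :
      {w | (G.deleteEdges S).Reachable v w}.Nontrivial := by
    have hadj := C.adj_snd hC.not_nil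
    exact ⟨v, .rfl, C.snd, hadj.reachable, hadj.ne⟩
  have hcompl : {z | (G.deleteEdges S).Reachable w z} ⊆ {z | (G.deleteEdges S).Reachable v z}ᶜ :=
    fun z hz hz' => h (Reachable.trans hz' (Reachable.symm hz))
  have hcut := hG _ (hnontrivial hC) ((hnontrivial hD).mono hcompl)
  have hle := cutSize_reachable_deleteEdges_le (G := G) S v
  omega

end HasOnlyTrivialThreeCuts

end ThreeCuts

section Girth

variable {V W : Type*}

theorem isCycle_cons_three {G : SimpleGraph V} {p q v : V} (hpq : G.Adj p q) (hqv : G.Adj q v)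
    (hvp : G.Adj v p) : (Walk.cons hpq (.cons hqv (.cons hvp .nil))).IsCycle := by
  have := hpq.ne
  have := hqv.ne
  have := hvp.ne
  simp only [Walk.cons_isCycle_iff, Walk.isPath_def, Walk.support_cons, Walk.support_nil,
    List.nodup_cons, List.mem_cons, List.not_mem_nil, List.nodup_nil, Walk.edges_cons,
    Walk.edges_nil, Sym2.eq_iff]
  grind

theorem isCycle_cons_four {G : SimpleGraph V} {p q v w : V} (hpq : G.Adj p q) (hqv : G.Adj q v)
    (hvw : G.Adj v w) (hwp : G.Adj w p) (hpv : p ≠ v) (hqw : q ≠ w) :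
    (Walk.cons hpq (.cons hqv (.cons hvw (.cons hwp .nil)))).IsCycle := by
  have := hpq.ne
  have := hqv.ne
  have := hvw.ne
  have := hwp.ne
  simp only [Walk.cons_isCycle_iff, Walk.isPath_def, Walk.support_cons, Walk.support_nil,
    List.nodup_cons, List.mem_cons, List.not_mem_nil, List.nodup_nil, Walk.edges_cons,
    Walk.edges_nil, Sym2.eq_iff]
  grind

theorem five_le_egirth_iff {G : SimpleGraph V} :
    5 ≤ G.egirth ↔ (∀ p q v, G.Adj p q → G.Adj q v → ¬ G.Adj v p) ∧
      ∀ p q v w, G.Adj p q → G.Adj q v → G.Adj v w → G.Adj w p → p = v ∨ q = w := by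
  rw [show (5 : ℕ∞) = ((5 : ℕ) : ℕ∞) from rfl, le_egirth]
  refine ⟨fun h => ⟨fun p q v hpq hqv hvp => ?_, fun p q v w hpq hqv hvw hwp => ?_⟩, ?_⟩
  · exact absurd (h p _ (isCycle_cons_three hpq hqv hvp)) (by norm_num)
  · by_contra! hne
    exact absurd (h p _ (isCycle_cons_four hpq hqv hvw hwp hne.1 hne.2)) (by norm_num)
  · rintro ⟨h3, h4⟩ p C hC
    have h := hC.three_le_length
    by_contra hlt
    rw [Nat.cast_le] at hlt
    match C with
    | .cons hpq (.cons hqv (.cons hvp .nil)) => exact h3 _ _ _ hpq hqv hvp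
    | .cons (v := q) hpq (.cons (v := v) hqv (.cons (v := w) hvw (.cons hwp .nil))) =>
      have := hC.support_nodup
      have := h4 _ _ _ _ hpq hqv hvw hwp
      simp_all
    | .nil => simp at h
    | .cons _ .nil => simp at h
    | .cons _ (.cons _ .nil) => simp at h
    | .cons _ (.cons _ (.cons _ (.cons _ (.cons _ _)))) =>
      simp only [Walk.length_cons] at hlt
      omega

theorem five_le_egirth_comap {G : SimpleGraph V} (f : W ↪ V) (h : 5 ≤ G.egirth) :
    5 ≤ (G.comap f).egirth := by
  rw [five_le_egirth_iff] at h ⊢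
  refine ⟨fun _ _ _ => h.1 _ _ _, fun p q v w h₁ h₂ h₃ h₄ => ?_⟩
  simpa only [f.injective.eq_iff] using h.2 _ _ _ _ h₁ h₂ h₃ h₄

theorem five_le_egirth_of_sum {G : SimpleGraph (V ⊕ W)} (hl : 5 ≤ (G.comap Sum.inl).egirth)
    (hr : 5 ≤ (G.comap Sum.inr).egirth)
    (hright : ∀ v w w', G.Adj (.inl v) (.inr w) → G.Adj (.inl v) (.inr w') → w = w')
    (hleft : ∀ v v' w, G.Adj (.inl v) (.inr w) → G.Adj (.inl v') (.inr w) → v = v')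
    (hindep : ∀ v v' w w', G.Adj (.inl v) (.inr w) → G.Adj (.inl v') (.inr w') →
      ¬ G.Adj (.inl v) (.inl v')) :
    5 ≤ G.egirth := by
  rw [five_le_egirth_iff] at hl hr ⊢
  simp only [comap_adj] at hl hr
  constructor
  · rintro (p | p) (q | q) (v | v) h₁ h₂ h₃ <;> grind [SimpleGraph.Adj.symm, SimpleGraph.Adj.ne]
  · rintro (p | p) (q | q) (v | v) (w | w) h₁ h₂ h₃ h₄ <;> grind [SimpleGraph.Adj.symm]

end Girth

section DotEdge

variable {V W : Type*}

theorem IsBoldEdge.symm {L : SimpleGraph V} {x y : V} (h : IsBoldEdge L x y) :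
    IsBoldEdge L y x where
  adj := h.adj.symm
  odd_delete_left := h.odd_delete_right
  odd_delete_right := h.odd_delete_left
  odd_containing F hF hyx := h.odd_containing F hF hyx.symm
  odd_avoiding F hF hyx := h.odd_avoiding F hF fun hxy => hyx hxy.symm

theorem IsTwoFactorWithNewEdge.symm {G H : SimpleGraph V} {p q : V}
    (h : IsTwoFactorWithNewEdge G H p q) : IsTwoFactorWithNewEdge G H q p :=
  ⟨h.1, h.2.2.1, h.2.1, fun v hq hp => h.2.2.2 v hp hq⟩

namespace IsGadgetPair

variable {R : SimpleGraph W} {a b c d : W}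

theorem nodup (h : IsGadgetPair R a b c d) : [a, b, c, d].Nodup := by
  have hab := h.adj_left.ne
  have hcd := h.adj_right.ne
  have hind := h.independent
  simp only [List.nodup_cons, List.mem_cons, List.not_mem_nil, List.nodup_nil]
  grind

theorem swap_left (h : IsGadgetPair R a b c d) : IsGadgetPair R b a c d where
  adj_left := h.adj_left.symm
  adj_right := h.adj_right
  independent := ⟨h.independent.2.2.1, h.independent.2.2.2, h.independent.1, h.independent.2.1⟩
  not_avoiding := by simpa only [adj_comm _ b a] using h.not_avoiding
  odd_one := by simpa only [adj_comm _ b a] using h.odd_one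
  odd_both := by simpa only [adj_comm _ b a] using h.odd_both
  different_cycles F hF hab hcd v C hC := by
    rw [Sym2.eq_swap (a := b)]
    exact h.different_cycles F hF hab.symm hcd v C hC
  even_new p q hp hq := by
    rw [Sym2.eq_swap (a := b)]
    exact h.even_new p q hp.symm hq
  odd_old p q hp hq := by
    rw [Sym2.eq_swap (a := b)]
    exact h.odd_old p q hp.symm hq

theorem symm (h : IsGadgetPair R a b c d) : IsGadgetPair R c d a b where
  adj_left := h.adj_right
  adj_right := h.adj_left
  independent := ⟨h.independent.1.symm, h.independent.2.2.1.symm, h.independent.2.1.symm,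
    h.independent.2.2.2.symm⟩
  not_avoiding := fun ⟨F, hF, hcd, hab⟩ => h.not_avoiding ⟨F, hF, hab, hcd⟩
  odd_one F hF hone := h.odd_one F hF (hone.symm.imp And.symm And.symm)
  odd_both F hF hcd hab := h.odd_both F hF hab hcd
  different_cycles F hF hcd hab v C hC hmem := h.different_cycles F hF hab hcd v C hC hmem.symm
  even_new p q hp hq H hH P hP := by
    rw [Set.pair_comm] at hH
    simpa only [Walk.length_reverse] using h.even_new q p hq hp H hH.symm P.reverse hP.reverse
  odd_old p q hp hq H hH := by
    rw [Set.pair_comm] at hH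
    exact h.odd_old q p hq hp H hH.symm

theorem swap_right (h : IsGadgetPair R a b c d) : IsGadgetPair R a b d c :=
  h.symm.swap_left.symm

end IsGadgetPair

/-- The neighbours of `x` are `y, r, s`, those of `y` are `x, t, u`, and these six vertices are
distinct: the configuration at which a dot product opens the left factor. -/
structure IsDotEdge (L : SimpleGraph V) (x y r s t u : V) : Prop where
  adj_left_iff : ∀ v, L.Adj x v ↔ v = y ∨ v = r ∨ v = s
  adj_right_iff : ∀ v, L.Adj y v ↔ v = x ∨ v = t ∨ v = u
  nodup : [x, y, r, s, t, u].Nodup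

namespace IsDotEdge

variable {L : SimpleGraph V} {x y r s t u : V}

theorem pairwise_ne (h : IsDotEdge L x y r s t u) :
    (x ≠ y ∧ x ≠ r ∧ x ≠ s ∧ x ≠ t ∧ x ≠ u) ∧ (y ≠ r ∧ y ≠ s ∧ y ≠ t ∧ y ≠ u) ∧
      (r ≠ s ∧ r ≠ t ∧ r ≠ u) ∧ (s ≠ t ∧ s ≠ u) ∧ t ≠ u := by
  have := h.nodup
  simp only [List.nodup_cons, List.mem_cons, List.not_mem_nil, List.nodup_nil] at this
  grind

theorem symm (h : IsDotEdge L x y r s t u) : IsDotEdge L y x t u r s where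
  adj_left_iff := h.adj_right_iff
  adj_right_iff := h.adj_left_iff
  nodup := by
    simp only [List.nodup_cons, List.mem_cons, List.not_mem_nil, List.nodup_nil]
    grind [h.pairwise_ne]

theorem swap_left (h : IsDotEdge L x y r s t u) : IsDotEdge L x y s r t u where
  adj_left_iff := fun v => (h.adj_left_iff v).trans (or_congr_right or_comm)
  adj_right_iff := h.adj_right_iff
  nodup := by
    simp only [List.nodup_cons, List.mem_cons, List.not_mem_nil, List.nodup_nil]
    grind [h.pairwise_ne]

theorem swap_right (h : IsDotEdge L x y r s t u) : IsDotEdge L x y r s u t :=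
  h.symm.swap_left.symm

theorem adj (h : IsDotEdge L x y r s t u) : L.Adj x y := (h.adj_left_iff y).2 (.inl rfl)

theorem adj_left (h : IsDotEdge L x y r s t u) : L.Adj x r :=
  (h.adj_left_iff r).2 (.inr (.inl rfl))

end IsDotEdge

theorem IsSnark.isDotEdge [Finite V] {L : SimpleGraph V} {x y r s t u : V} (hL : IsSnark L)
    (hxy : L.Adj x y) (hx : L.neighborSet x \ {y} = {r, s}) (hy : L.neighborSet y \ {x} = {t, u}) :
    IsDotEdge L x y r s t u := by
  have key {x y r s : V} (hxy : L.Adj x y) (hx : L.neighborSet x \ {y} = {r, s}) :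
      r ≠ s ∧ ∀ v, L.Adj x v ↔ v = y ∨ v = r ∨ v = s := by
    constructor
    · rintro rfl
      have hcard := Set.ncard_sdiff_singleton_of_mem (show y ∈ L.neighborSet x from hxy)
      rw [hx, hL.cubic x, Set.pair_eq_singleton, Set.ncard_singleton] at hcard
      omega
    · intro v
      have hv := Set.ext_iff.1 hx v
      simp only [Set.mem_sdiff, mem_neighborSet, Set.mem_singleton_iff, Set.mem_insert_iff] at hv
      grind
  obtain ⟨hrs, hxv⟩ := key hxy hx
  obtain ⟨htu, hyv⟩ := key hxy.symm hy
  have htri v (hv : L.Adj x v) (hv' : L.Adj y v) : False :=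
    (five_le_egirth_iff.1 hL.girth).1 x y v hxy hv' hv.symm
  have hr : L.Adj x r ∧ r ≠ y := hx.ge (Set.mem_insert r _)
  have hs : L.Adj x s ∧ s ≠ y := hx.ge (Set.mem_insert_of_mem r rfl)
  have ht : L.Adj y t ∧ t ≠ x := hy.ge (Set.mem_insert t _)
  have hu : L.Adj y u ∧ u ≠ x := hy.ge (Set.mem_insert_of_mem t rfl)
  refine ⟨hxv, hyv, ?_⟩
  simp only [List.nodup_cons, List.mem_cons, List.not_mem_nil, List.nodup_nil]
  grind [SimpleGraph.Adj.ne]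

end DotEdge

section Joined

variable {V W : Type*}

/-- The disjoint union of `Q` and `P` together with the edges between them listed in `J`. -/
def joined (Q : SimpleGraph V) (P : SimpleGraph W) (J : Set (V × W)) : SimpleGraph (V ⊕ W) :=
  (Q ⊕g P) ⊔ fromRel fun m n => ∃ z ∈ J, m = .inl z.1 ∧ n = .inr z.2

variable {Q : SimpleGraph V} {P : SimpleGraph W} {J : Set (V × W)}

theorem joined_adj_inl_inl {v v' : V} : (joined Q P J).Adj (.inl v) (.inl v') ↔ Q.Adj v v' := by
  simp [joined]

theorem joined_adj_inr_inr {w w' : W} : (joined Q P J).Adj (.inr w) (.inr w') ↔ P.Adj w w' := by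
  simp [joined]

theorem joined_adj_inl_inr {v : V} {w : W} :
    (joined Q P J).Adj (.inl v) (.inr w) ↔ (v, w) ∈ J := by
  simp [joined]

theorem joined_empty (Q : SimpleGraph V) (P : SimpleGraph W) : joined Q P ∅ = Q ⊕g P := by
  ext (v | v) (w | w) <;> simp [joined]

theorem joined_insert (Q : SimpleGraph V) (P : SimpleGraph W) (J : Set (V × W)) (v : V) (w : W) :
    joined Q P (insert (v, w) J) = joined Q P J ⊔ edge (.inl v) (.inr w) := by
  ext (p | p) (q | q) <;> simp [joined, edge_adj] <;> grind

theorem joined_singleton (Q : SimpleGraph V) (P : SimpleGraph W) (v : V) (w : W) :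
    joined Q P {(v, w)} = (Q ⊕g P) ⊔ edge (.inl v) (.inr w) := by
  rw [← insert_empty_eq, joined_insert, joined_empty]

theorem joined_pair (p q : V) (e f : W) : joined Q P {(p, e), (q, f)} =
    (Q ⊕g P) ⊔ edge (.inl p) (.inr e) ⊔ edge (.inl q) (.inr f) := by
  rw [joined_insert, joined_singleton, sup_right_comm]

theorem joined_quadruple (r s t u : V) (a b c d : W) :
    joined Q P {(r, a), (s, b), (t, c), (u, d)} =
      (Q ⊕g P) ⊔ edge (.inl r) (.inr a) ⊔ edge (.inl s) (.inr b) ⊔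
        edge (.inl t) (.inr c) ⊔ edge (.inl u) (.inr d) := by
  rw [joined_insert, joined_insert, joined_pair]
  ac_rfl

theorem eq_joined (K : SimpleGraph (V ⊕ W)) :
    K = joined (K.comap .inl) (K.comap .inr) {z | K.Adj (.inl z.1) (.inr z.2)} := by
  ext (p | p) (q | q) <;> simp [joined, adj_comm]

theorem delta_inl_inr (v : V) (w : W) : delta (Sum.inl v : V ⊕ W) (.inr w) = 0 := by simp [delta]

theorem delta_inr_inl (v : V) (w : W) : delta (Sum.inr w : V ⊕ W) (.inl v) = 0 := by simp [delta]

variable [Finite V] [Finite W]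

theorem valency_joined_insert_inl {v : V} {w : W} (h : (v, w) ∉ J) (z : V) :
    valency (joined Q P (insert (v, w) J)) (.inl z) =
      valency (joined Q P J) (.inl z) + delta v z := by
  rw [joined_insert, valency_sup_edge Sum.inl_ne_inr (joined_adj_inl_inr.not.2 h),
    delta_map Sum.inl_injective, delta_inr_inl, add_zero]

theorem valency_joined_insert_inr {v : V} {w : W} (h : (v, w) ∉ J) (z : W) :
    valency (joined Q P (insert (v, w) J)) (.inr z) =
      valency (joined Q P J) (.inr z) + delta w z := by
  rw [joined_insert, valency_sup_edge Sum.inl_ne_inr (joined_adj_inl_inr.not.2 h),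
    delta_map Sum.inr_injective, delta_inl_inr, add_zero]

theorem valency_joined_pair_inl {p q : V} {e f : W} (hpq : p ≠ q) (v : V) :
    valency (joined Q P {(p, e), (q, f)}) (.inl v) = valency Q v + delta p v + delta q v := by
  rw [valency_joined_insert_inl (by simp [hpq]), ← insert_empty_eq,
    valency_joined_insert_inl (Set.notMem_empty _), joined_empty, valency_sum_inl, add_right_comm]

theorem valency_joined_pair_inr {p q : V} {e f : W} (hpq : p ≠ q) (w : W) :
    valency (joined Q P {(p, e), (q, f)}) (.inr w) = valency P w + delta e w + delta f w := by
  rw [valency_joined_insert_inr (by simp [hpq]), ← insert_empty_eq,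
    valency_joined_insert_inr (Set.notMem_empty _), joined_empty, valency_sum_inr, add_right_comm]

theorem valency_joined_quadruple_inl {r s t u : V} {a b c d : W} (h : [r, s, t, u].Nodup) (v : V) :
    valency (joined Q P {(r, a), (s, b), (t, c), (u, d)}) (.inl v) =
      valency Q v + delta r v + delta s v + delta t v + delta u v := by
  simp only [List.nodup_cons, List.mem_cons, List.not_mem_nil, List.nodup_nil] at h
  rw [valency_joined_insert_inl (by grind), valency_joined_insert_inl (by grind),
    valency_joined_pair_inl (by grind)]
  ring

theorem valency_joined_quadruple_inr {r s t u : V} {a b c d : W} (h : [r, s, t, u].Nodup) (w : W) :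
    valency (joined Q P {(r, a), (s, b), (t, c), (u, d)}) (.inr w) =
      valency P w + delta a w + delta b w + delta c w + delta d w := by
  simp only [List.nodup_cons, List.mem_cons, List.not_mem_nil, List.nodup_nil] at h
  rw [valency_joined_insert_inr (by grind), valency_joined_insert_inr (by grind),
    valency_joined_pair_inr (by grind)]
  ring

end Joined

section OddTwoFactors

variable {V W : Type*}

theorem sup_edge_sum (Q : SimpleGraph V) (P : SimpleGraph W) (p q : V) :
    (Q ⊔ edge p q) ⊕g P = (Q ⊕g P) ⊔ edge (.inl p) (.inl q) := by
  ext (v | v) (w | w) <;> simp [edge_adj]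

theorem reachable_sup_edge_of_isolated {K : SimpleGraph V} {p q w : V} (hp : ∀ z, ¬ K.Adj p z)
    (hq : ∀ z, ¬ K.Adj q z) : (K ⊔ edge p q).Reachable p w ↔ w = p ∨ w = q := by
  constructor
  · refine mem_of_reachable (S := {w | w = p ∨ w = q}) (fun v hv w hvw => ?_) (.inl rfl)
    simp only [Set.mem_ofPred_eq, sup_adj, edge_adj] at hv hvw ⊢
    grind
  · rintro (rfl | rfl)
    · exact .rfl
    · by_cases h : p = w
      · exact h ▸ .rfl
      · exact Adj.reachable (by simp [edge_adj, h])

theorem IsTwoFactor.odd_compCard [Finite V] {G F : SimpleGraph V} (hF : IsTwoFactor G F)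
    (hodd : IsOdd F) (v : V) : Odd (compCard F v) :=
  hodd.odd_compCard fun w _ => hF.2 w

theorem map_comap_eq {f : W ↪ V} {H : SimpleGraph V}
    (h : ∀ v w, H.Adj v w → v ∈ Set.range f) : (H.comap f).map f = H := by
  refine le_antisymm (map_comap_le f H) fun v w hvw => ?_
  obtain ⟨v, rfl⟩ := h v w hvw
  obtain ⟨w, rfl⟩ := h w _ hvw.symm
  exact (map_adj f _ _ _).2 ⟨v, w, hvw, rfl, rfl⟩

theorem odd_compCard_of_delete [Finite V] {L H : SimpleGraph V} {y : V}
    (hodd : ∀ F, IsTwoFactor (L.induce {y}ᶜ) F → IsOdd F) (hH : H ≤ L) (hy : valency H y = 0)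
    (h2 : ∀ v ≠ y, valency H v = 2) {v : V} (hv : v ≠ y) : Odd (compCard H v) := by
  let f := Function.Embedding.subtype fun v : V => v ∈ ({y}ᶜ : Set V)
  have hmap : (H.comap f).map f = H := map_comap_eq fun v w hvw =>
    ⟨⟨v, by rintro rfl; exact valency_eq_zero_iff.1 hy w hvw⟩, rfl⟩
  have hF : IsTwoFactor (L.induce {y}ᶜ) (H.comap f) :=
    ⟨comap_monotone f hH, fun z => by
      change valency _ _ = 2
      rw [← valency_map f, hmap]
      exact h2 z z.2⟩
  have := hF.odd_compCard (hodd _ hF) ⟨v, hv⟩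
  rwa [← compCard_map f, hmap] at this

end OddTwoFactors

section Gadget

variable {W : Type*} [Finite W] {R P F : SimpleGraph W} {a b c d : W}

namespace IsGadgetPair

theorem odd_compCard_of_left (hg : IsGadgetPair R a b c d) (hP : P ≤ R) (hab : ¬ P.Adj a b)
    (hcd : ¬ P.Adj c d) (h2 : ∀ w, valency P w + delta a w + delta b w = 2) :
    P.Reachable a b ∧ ∀ w, Odd (compCard P w) := by
  have hind := hg.independent
  have hne := hg.adj_left.ne
  have hreach : P.Reachable a b := by
    obtain ⟨q, hqa, hq, hqodd⟩ := exists_odd_valency_reachable (K := P) (p := a) <| by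
      have := h2 a
      grind [delta]
    have := h2 q
    obtain rfl : q = b := by grind [delta]
    exact hq
  have hF : IsTwoFactor R (P ⊔ edge a b) :=
    ⟨sup_le hP ((edge_le_iff R).2 (.inr hg.adj_left)), fun w =>
      (valency_sup_edge hne hab w).trans (h2 w)⟩
  have hodd := hg.odd_one _ hF (.inl ⟨by simp [edge_adj, hne], by rw [sup_adj, edge_adj]; grind⟩)
  refine ⟨hreach, fun w => ?_⟩
  rw [← compCard_sup_edge_of_reachable hreach]
  exact hF.odd_compCard hodd w

theorem odd_compCard_of_cross (hg : IsGadgetPair R a b c d) (hP : P ≤ R) (hab : ¬ P.Adj a b)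
    (hcd : ¬ P.Adj c d) (h2 : ∀ w, valency P w + delta a w + delta c w = 2) :
    P.Reachable a c ∧ Even (compCard P a) ∧
      ∀ w, ¬ P.Reachable a w → Odd (compCard P w) := by
  have hac := hg.independent.1
  have ha : valency P a = 1 := by have := h2 a; grind [delta]
  have hc : valency P c = 1 := by have := h2 c; grind [delta]
  have hw w (hwa : w ≠ a) (hwc : w ≠ c) : valency P w = 2 := by have := h2 w; grind [delta]
  have hreach : P.Reachable a c := by
    obtain ⟨q, hqa, hq, hqodd⟩ := exists_odd_valency_reachable (K := P) (p := a) (by simp [ha])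
    obtain rfl : q = c := by_contra fun hqc => by rw [hw q hqa hqc] at hqodd; contradiction
    exact hq
  have hnew : IsTwoFactorWithNewEdge (R.deleteEdges {s(a, b), s(c, d)}) P a c := by
    refine ⟨fun v w hvw => deleteEdges_adj.2 ⟨hP hvw, ?_⟩, ha, hc, hw⟩
    rintro (h | h)
    · exact hab (by rwa [← mem_edgeSet, ← h])
    · exact hcd (by rwa [← mem_edgeSet, ← Set.mem_singleton_iff.1 h])
  refine ⟨hreach, ?_, fun w haw => ?_⟩
  · obtain ⟨p, hp⟩ := hreach.exists_isPath
    rw [compCard_eq_length_add_one hp hac ha hc hw]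
    exact hg.even_new a c (.inl rfl) (.inl rfl) P hnew p hp
  · refine (hg.odd_old a c (.inl rfl) (.inl rfl) P hnew).odd_compCard fun z hz => hw z ?_ ?_
    · rintro rfl
      exact haw hz.symm
    · rintro rfl
      exact haw (hreach.trans hz.symm)

theorem not_reachable_of_both (hg : IsGadgetPair R a b c d) (hF : IsTwoFactor R F)
    (hab : F.Adj a b) (hcd : F.Adj c d) : ¬ F.Reachable a c := by
  intro hac
  obtain ⟨v, hv, C, hC⟩ := exists_isCycle_of_valency_eq_two (v := a) fun w _ => hF.2 w
  have hval w (hw : w ∈ C.support) := valency_le_of_isCycle hC hw (hF.2 w)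
  have hmem w (hw : F.Reachable a w) : w ∈ C.support :=
    (reachable_iff_mem_support hval w).1 (hv.symm.trans hw)
  exact hg.different_cycles F hF hab hcd v C hC
    ⟨mem_edges_of_adj (hval a (hmem a .rfl)) hab, mem_edges_of_adj (hval c (hmem c hac)) hcd⟩

theorem isTwoFactor_sup_edge_sup_edge (hg : IsGadgetPair R a b c d) (hP : P ≤ R)
    (hab : ¬ P.Adj a b) (hcd : ¬ P.Adj c d)
    (h2 : ∀ w, valency P w + delta a w + delta b w + delta c w + delta d w = 2) :
    IsTwoFactor R (P ⊔ edge a b ⊔ edge c d) := by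
  have hind := hg.independent
  have hcd' : ¬ (P ⊔ edge a b).Adj c d := by
    rw [sup_adj, edge_adj]
    grind
  refine ⟨sup_le (sup_le hP ((edge_le_iff R).2 (.inr hg.adj_left)))
    ((edge_le_iff R).2 (.inr hg.adj_right)), fun w => ?_⟩
  rw [← valency, valency_sup_edge hg.adj_right.ne hcd', valency_sup_edge hg.adj_left.ne hab, h2]

theorem reachable_of_both (hg : IsGadgetPair R a b c d) (hP : P ≤ R) (hab : ¬ P.Adj a b)
    (hcd : ¬ P.Adj c d)
    (h2 : ∀ w, valency P w + delta a w + delta b w + delta c w + delta d w = 2) :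
    P.Reachable a b ∧ ¬ P.Reachable a c := by
  have hnodup := hg.nodup
  set F := P ⊔ edge a b ⊔ edge c d
  have hle : P ≤ F := le_sup_left.trans le_sup_left
  have habF : F.Adj a b := by simp [F, edge_adj, hg.adj_left.ne]
  have hcdF : F.Adj c d := by simp [F, edge_adj, hg.adj_right.ne]
  have hac := hg.not_reachable_of_both (hg.isTwoFactor_sup_edge_sup_edge hP hab hcd h2) habF hcdF
  refine ⟨?_, fun h => hac (h.mono hle)⟩
  obtain ⟨q, hqa, hq, hqodd⟩ := exists_odd_valency_reachable (K := P) (p := a) <| by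
    have := h2 a
    grind [delta]
  have hqc : q ≠ c := by
    rintro rfl
    exact hac (hq.mono hle)
  have hqd : q ≠ d := by
    rintro rfl
    exact hac ((hq.mono hle).trans hcdF.symm.reachable)
  have := h2 q
  obtain rfl : q = b := by grind [delta]
  exact hq

theorem odd_compCard_of_both (hg : IsGadgetPair R a b c d) (hP : P ≤ R) (hab : ¬ P.Adj a b)
    (hcd : ¬ P.Adj c d)
    (h2 : ∀ w, valency P w + delta a w + delta b w + delta c w + delta d w = 2) (w : W) :
    Odd (compCard P w) := by
  have hF := hg.isTwoFactor_sup_edge_sup_edge hP hab hcd h2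
  have hreach := (hg.reachable_of_both hP hab hcd h2).1
  have hreach' := (hg.symm.reachable_of_both hP hcd hab fun w => by rw [← h2 w]; ring).1
  rw [← compCard_sup_edge_of_reachable hreach,
    ← compCard_sup_edge_of_reachable (hreach'.mono le_sup_left)]
  exact hF.odd_compCard (hg.odd_both _ hF (by simp [edge_adj, hg.adj_left.ne])
    (by simp [edge_adj, hg.adj_right.ne])) w

end IsGadgetPair

end Gadget

section BoldEdge

variable {V : Type*} [Finite V] {L Q : SimpleGraph V} {x y r s t u : V}

theorem odd_compCard_left (hL : IsDotEdge L x y r s t u) (hxy : IsBoldEdge L x y) (hQ : Q ≤ L)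
    (h2 : ∀ v, valency Q v + delta r v + delta s v + 2 * delta x v + 2 * delta y v = 2) {v : V}
    (hv : v ≠ y) : Odd (compCard (Q ⊔ edge r x ⊔ edge s x) v) := by
  have hne := hL.pairwise_ne
  have hx : ∀ z, ¬ Q.Adj x z := valency_eq_zero_iff.1 (by have := h2 x; grind [delta])
  have hr : ¬ Q.Adj r x := fun h => hx r h.symm
  have hs : ¬ (Q ⊔ edge r x).Adj s x := by
    rw [sup_adj, edge_adj]
    grind [SimpleGraph.Adj.symm]
  have hval (v : V) : valency (Q ⊔ edge r x ⊔ edge s x) v + 2 * delta y v = 2 := by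
    rw [valency_sup_edge (by grind) hs, valency_sup_edge (by grind) hr]
    exact (by ring : _ = _).trans (h2 v)
  refine odd_compCard_of_delete hxy.odd_delete_right
    (sup_le (sup_le hQ ((edge_le_iff L).2 (.inr ?_))) ((edge_le_iff L).2 (.inr ?_))) ?_ ?_ hv
  · exact hL.adj_left.symm
  · exact hL.swap_left.adj_left.symm
  · have := hval y
    grind [delta]
  · intro v hv
    have := hval v
    grind [delta]

theorem odd_compCard_cross (hL : IsDotEdge L x y r s t u) (hxy : IsBoldEdge L x y) (hQ : Q ≤ L)
    (h2 : ∀ v, valency Q v + delta r v + delta t v + 2 * delta x v + 2 * delta y v = 2) (v : V) :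
    Odd (compCard (Q ⊔ edge x y ⊔ edge r x ⊔ edge t y) v) := by
  have hne := hL.pairwise_ne
  have hx : ∀ z, ¬ Q.Adj x z := valency_eq_zero_iff.1 (by have := h2 x; grind [delta])
  have hy : ∀ z, ¬ Q.Adj y z := valency_eq_zero_iff.1 (by have := h2 y; grind [delta])
  have hr : ¬ (Q ⊔ edge x y).Adj r x := by
    rw [sup_adj, edge_adj]
    grind [SimpleGraph.Adj.symm]
  have ht : ¬ (Q ⊔ edge x y ⊔ edge r x).Adj t y := by
    rw [sup_adj, sup_adj, edge_adj, edge_adj]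
    grind [SimpleGraph.Adj.symm]
  have hF : IsTwoFactor L (Q ⊔ edge x y ⊔ edge r x ⊔ edge t y) := by
    refine ⟨?_, fun v => ?_⟩
    · simp only [sup_le_iff, edge_le_iff]
      exact ⟨⟨⟨hQ, .inr hL.adj⟩, .inr hL.adj_left.symm⟩, .inr hL.symm.adj_left.symm⟩
    · rw [← valency, valency_sup_edge (by grind) ht, valency_sup_edge (by grind) hr,
        valency_sup_edge (by grind) (hx y), ← h2 v]
      ring
  exact hF.odd_compCard (hxy.odd_containing _ hF (by simp [edge_adj, hL.adj.ne])) v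

theorem odd_compCard_both (hL : IsDotEdge L x y r s t u) (hxy : IsBoldEdge L x y) (hQ : Q ≤ L)
    (h2 : ∀ v, valency Q v + delta r v + delta s v + delta t v + delta u v +
      2 * delta x v + 2 * delta y v = 2) (v : V) :
    Odd (compCard (Q ⊔ edge t y ⊔ edge u y ⊔ edge r x ⊔ edge s x) v) := by
  have hne := hL.pairwise_ne
  have hx : ∀ z, ¬ Q.Adj x z := valency_eq_zero_iff.1 (by have := h2 x; grind [delta])
  have hy : ∀ z, ¬ Q.Adj y z := valency_eq_zero_iff.1 (by have := h2 y; grind [delta])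
  have ht : ¬ Q.Adj t y := fun h => hy t h.symm
  have hu : ¬ (Q ⊔ edge t y).Adj u y := by
    rw [sup_adj, edge_adj]
    grind [SimpleGraph.Adj.symm]
  have hr : ¬ (Q ⊔ edge t y ⊔ edge u y).Adj r x := by
    simp only [sup_adj, edge_adj]
    grind [SimpleGraph.Adj.symm]
  have hs : ¬ (Q ⊔ edge t y ⊔ edge u y ⊔ edge r x).Adj s x := by
    simp only [sup_adj, edge_adj]
    grind [SimpleGraph.Adj.symm]
  have hF : IsTwoFactor L (Q ⊔ edge t y ⊔ edge u y ⊔ edge r x ⊔ edge s x) := by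
    refine ⟨?_, fun v => ?_⟩
    · simp only [sup_le_iff, edge_le_iff]
      exact ⟨⟨⟨⟨hQ, .inr hL.symm.adj_left.symm⟩, .inr hL.swap_right.symm.adj_left.symm⟩,
        .inr hL.adj_left.symm⟩, .inr hL.swap_left.adj_left.symm⟩
    · rw [← valency, valency_sup_edge (by grind) hs, valency_sup_edge (by grind) hr,
        valency_sup_edge (by grind) hu, valency_sup_edge (by grind) ht, ← h2 v]
      ring
  refine hF.odd_compCard (hxy.odd_avoiding _ hF ?_) v
  simp only [sup_adj, edge_adj]
  grind

end BoldEdge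

section OddDotProduct

variable {V W : Type*} [Finite V] [Finite W] {L Q : SimpleGraph V} {R P : SimpleGraph W}
  {x y r s t u : V} {a b c d : W}

theorem odd_compCard_joined_left (hL : IsDotEdge L x y r s t u) (hxy : IsBoldEdge L x y)
    (hg : IsGadgetPair R a b c d) (hQ : Q ≤ L) (hP : P ≤ R) (hab : ¬ P.Adj a b)
    (hcd : ¬ P.Adj c d)
    (hQ2 : ∀ v, valency Q v + delta r v + delta s v + 2 * delta x v + 2 * delta y v = 2)
    (hP2 : ∀ w, valency P w + delta a w + delta b w = 2) :
    ∀ z ∉ ({.inl x, .inl y} : Set (V ⊕ W)),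
      Odd (compCard ((Q ⊕g P) ⊔ edge (.inl r) (.inr a) ⊔ edge (.inl s) (.inr b)) z) := by
  have hne := hL.pairwise_ne
  have hx : ∀ z, ¬ Q.Adj x z := valency_eq_zero_iff.1 (by have := hQ2 x; grind [delta])
  obtain ⟨habP, hoddP⟩ := hg.odd_compCard_of_left hP hab hcd hP2
  have har (v : V) : ¬ (Q ⊕g P).Reachable (.inr a) (.inl v) := by simp [reachable_sum_inr]
  refine odd_compCard_reroute_of_isolated (p := .inl x) ?_ (.inl rfl)
    (reachable_sum_inr.2 ⟨b, habP, rfl⟩) ?_ ?_ (har r) (har s) ?_ ?_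
  · rintro (z | z) <;> simp [hx]
  · grind
  · grind
  · rw [compCard_sum_inr]
    exact hoddP a
  rintro (v | w) hv -
  all_goals rw [← sup_edge_sum, ← sup_edge_sum]
  · rw [compCard_sum_inl]
    exact odd_compCard_left hL hxy hQ hQ2 fun hvy => hv (.inr (congrArg _ hvy))
  · rw [compCard_sum_inr]
    exact hoddP w

theorem odd_compCard_joined_cross_sup_edge (hL : IsDotEdge L x y r s t u) (hxy : IsBoldEdge L x y)
    (hg : IsGadgetPair R a b c d) (hQ : Q ≤ L) (hP : P ≤ R) (hab : ¬ P.Adj a b)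
    (hcd : ¬ P.Adj c d)
    (hQ2 : ∀ v, valency Q v + delta r v + delta t v + 2 * delta x v + 2 * delta y v = 2)
    (hP2 : ∀ w, valency P w + delta a w + delta c w = 2) :
    ∀ z ∉ ({.inl x, .inl y} : Set (V ⊕ W)),
      Odd (compCard (((Q ⊔ edge x y) ⊕g P) ⊔ edge (.inl r) (.inr a) ⊔
        edge (.inl t) (.inr c)) z) := by
  have hne := hL.pairwise_ne
  have hx : ∀ z, ¬ Q.Adj x z := valency_eq_zero_iff.1 (by have := hQ2 x; grind [delta])
  have hy : ∀ z, ¬ Q.Adj y z := valency_eq_zero_iff.1 (by have := hQ2 y; grind [delta])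
  obtain ⟨hacP, hevenP, hoddP⟩ := hg.odd_compCard_of_cross hP hab hcd hP2
  have hxB (z : V ⊕ W) :
      ((Q ⊔ edge x y) ⊕g P).Reachable (.inl x) z ↔ z = .inl x ∨ z = .inl y := by
    simp only [reachable_sum_inl, reachable_sup_edge_of_isolated hx hy]
    grind
  have hxcard : compCard ((Q ⊔ edge x y) ⊕g P) (.inl x) = 2 := by
    simp only [compCard, hxB]
    exact Set.ncard_pair (Sum.inl_injective.ne hL.adj.ne)
  have har (v : V) : ¬ ((Q ⊔ edge x y) ⊕g P).Reachable (.inr a) (.inl v) := by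
    simp [reachable_sum_inr]
  refine odd_compCard_reroute ((hxB (.inl y)).2 (.inr rfl)) (reachable_sum_inr.2 ⟨c, hacP, rfl⟩)
    (fun z hz => (hxB z).1 hz) ?_ ?_ (har r) (har t) ?_ ?_
  · grind
  · grind
  · rw [hxcard, compCard_sum_inr]
    exact iff_of_false (by decide) (Nat.not_odd_iff_even.2 hevenP)
  rintro (v | w) - hav
  all_goals rw [← sup_edge_sum, ← sup_edge_sum]
  · rw [compCard_sum_inl]
    exact odd_compCard_cross hL hxy hQ hQ2 v
  · rw [compCard_sum_inr]
    exact hoddP w fun h => hav (reachable_sum_inr.2 ⟨w, h, rfl⟩)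

theorem odd_compCard_joined_cross (hL : IsDotEdge L x y r s t u) (hxy : IsBoldEdge L x y)
    (hg : IsGadgetPair R a b c d) (hQ : Q ≤ L) (hP : P ≤ R) (hab : ¬ P.Adj a b)
    (hcd : ¬ P.Adj c d)
    (hQ2 : ∀ v, valency Q v + delta r v + delta t v + 2 * delta x v + 2 * delta y v = 2)
    (hP2 : ∀ w, valency P w + delta a w + delta c w = 2) :
    ∀ z ∉ ({.inl x, .inl y} : Set (V ⊕ W)),
      Odd (compCard ((Q ⊕g P) ⊔ edge (.inl r) (.inr a) ⊔ edge (.inl t) (.inr c)) z) := by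
  have hne := hL.pairwise_ne
  have hx : ∀ z, ¬ Q.Adj x z := valency_eq_zero_iff.1 (by have := hQ2 x; grind [delta])
  have hy : ∀ z, ¬ Q.Adj y z := valency_eq_zero_iff.1 (by have := hQ2 y; grind [delta])
  intro z hz
  set K := (Q ⊕g P) ⊔ edge (.inl r) (.inr a) ⊔ edge (.inl t) (.inr c) with hK
  have hKxy : ((Q ⊔ edge x y) ⊕g P) ⊔ edge (.inl r) (.inr a) ⊔ edge (.inl t) (.inr c) =
      K ⊔ edge (.inl x) (.inl y) := by
    rw [hK, sup_edge_sum]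
    ac_rfl
  have hKx (w : V ⊕ W) : ¬ K.Adj (.inl x) w := by
    rcases w with w | w <;> simp only [K, sup_adj, edge_adj, sum_adj_inl, not_adj_sum_inl_inr, hx]
    all_goals grind
  have hKy (w : V ⊕ W) : ¬ K.Adj (.inl y) w := by
    rcases w with w | w <;> simp only [K, sup_adj, edge_adj, sum_adj_inl, not_adj_sum_inl_inr, hy]
    all_goals grind
  rw [← compCard_sup_edge_of_not_reachable
    (fun h => hz (.inl (eq_of_reachable_of_forall_not_adj hKx h.symm)))
    (fun h => hz (.inr (eq_of_reachable_of_forall_not_adj hKy h.symm))), ← hKxy]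
  exact odd_compCard_joined_cross_sup_edge hL hxy hg hQ hP hab hcd hQ2 hP2 z hz

theorem odd_compCard_joined_both_left (hL : IsDotEdge L x y r s t u) (hxy : IsBoldEdge L x y)
    (hg : IsGadgetPair R a b c d) (hQ : Q ≤ L) (hP : P ≤ R) (hab : ¬ P.Adj a b)
    (hcd : ¬ P.Adj c d)
    (hQ2 : ∀ v, valency Q v + delta r v + delta s v + delta t v + delta u v +
      2 * delta x v + 2 * delta y v = 2)
    (hP2 : ∀ w, valency P w + delta a w + delta b w + delta c w + delta d w = 2) :
    ∀ z ∉ ({.inl x} : Set (V ⊕ W)), Odd (compCard (((Q ⊔ edge t y ⊔ edge u y) ⊕g P) ⊔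
      edge (.inl r) (.inr a) ⊔ edge (.inl s) (.inr b)) z) := by
  have hne := hL.pairwise_ne
  have hx : ∀ z, ¬ Q.Adj x z := valency_eq_zero_iff.1 (by have := hQ2 x; grind [delta])
  have hoddP := hg.odd_compCard_of_both hP hab hcd hP2
  obtain ⟨habP, -⟩ := hg.reachable_of_both hP hab hcd hP2
  have har (v : V) : ¬ ((Q ⊔ edge t y ⊔ edge u y) ⊕g P).Reachable (.inr a) (.inl v) := by
    simp [reachable_sum_inr]
  refine odd_compCard_reroute_of_isolated (p := .inl x) ?_ rfl
    (reachable_sum_inr.2 ⟨b, habP, rfl⟩) ?_ ?_ (har r) (har s) ?_ ?_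
  · rintro (z | z)
    · simp only [sum_adj_inl, sup_adj, edge_adj, hx]
      grind
    · simp
  · grind
  · grind
  · rw [compCard_sum_inr]
    exact hoddP a
  rintro (v | w) - -
  all_goals rw [← sup_edge_sum, ← sup_edge_sum]
  · rw [compCard_sum_inl]
    exact odd_compCard_both hL hxy hQ hQ2 v
  · rw [compCard_sum_inr]
    exact hoddP w

theorem odd_compCard_joined_both (hL : IsDotEdge L x y r s t u) (hxy : IsBoldEdge L x y)
    (hg : IsGadgetPair R a b c d) (hQ : Q ≤ L) (hP : P ≤ R) (hab : ¬ P.Adj a b)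
    (hcd : ¬ P.Adj c d)
    (hQ2 : ∀ v, valency Q v + delta r v + delta s v + delta t v + delta u v +
      2 * delta x v + 2 * delta y v = 2)
    (hP2 : ∀ w, valency P w + delta a w + delta b w + delta c w + delta d w = 2) :
    ∀ z ∉ ({.inl x, .inl y} : Set (V ⊕ W)),
      Odd (compCard ((Q ⊕g P) ⊔ edge (.inl r) (.inr a) ⊔ edge (.inl s) (.inr b) ⊔
        edge (.inl t) (.inr c) ⊔ edge (.inl u) (.inr d)) z) := by
  have hne := hL.pairwise_ne
  have hy : ∀ z, ¬ Q.Adj y z := valency_eq_zero_iff.1 (by have := hQ2 y; grind [delta])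
  obtain ⟨habP, hacP⟩ := hg.reachable_of_both hP hab hcd hP2
  obtain ⟨hcdP, -⟩ := hg.symm.reachable_of_both hP hcd hab fun w => by rw [← hP2 w]; ring
  set B := (Q ⊕g P) ⊔ edge (.inl r) (.inr a) ⊔ edge (.inl s) (.inr b) with hB
  have hcB (w z : V ⊕ W) (hw : (Q ⊕g P).Reachable (.inr c) w) (hz : B.Adj w z) :
      (Q ⊕g P).Reachable (.inr c) z := by
    obtain ⟨w, hcw, rfl⟩ := reachable_sum_inr.1 hw
    have hwa : w ≠ a := fun h => hacP (h ▸ hcw.symm)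
    have hwb : w ≠ b := fun h => hacP (habP.trans (h ▸ hcw.symm))
    refine hw.trans (Adj.reachable ?_)
    simpa [B, edge_adj, hwa, hwb] using hz
  have hle : Q ⊕g P ≤ B := le_sup_left.trans le_sup_left
  have hct (v : V) : ¬ B.Reachable (.inr c) (.inl v) := by
    simp [reachable_iff_of_le hle hcB, reachable_sum_inr]
  refine odd_compCard_reroute_of_isolated (p := .inl y) ?_ (.inr rfl)
    (.mono hle (reachable_sum_inr.2 ⟨d, hcdP, rfl⟩)) ?_ ?_ (hct t) (hct u) ?_ ?_
  · rintro (z | z) <;> simp only [B, sup_adj, edge_adj, sum_adj_inl, not_adj_sum_inl_inr, hy]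
    all_goals grind
  · grind
  · grind
  · rw [compCard_eq_of_le hle hcB, compCard_sum_inr]
    exact hg.odd_compCard_of_both hP hab hcd hP2 c
  rintro z hz -
  have hB' : B ⊔ edge (.inl t) (.inl y) ⊔ edge (.inl u) (.inl y) =
      ((Q ⊔ edge t y ⊔ edge u y) ⊕g P) ⊔ edge (.inl r) (.inr a) ⊔ edge (.inl s) (.inr b) := by
    rw [hB, sup_edge_sum, sup_edge_sum]
    ac_rfl
  rw [hB']
  exact odd_compCard_joined_both_left hL hxy hg hQ hP hab hcd hQ2 hP2 z fun h => hz (.inl h)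

end OddDotProduct

section CaseDistinction

theorem exists_image_eq_of_subset_range {α : Type*} {f : Fin 4 → α} (hf : f.Injective) {J : Set α}
    (hJ : J ⊆ Set.range f) (heven : Even J.ncard) :
    ∃ I ∈ ({∅, {0, 1}, {2, 3}, {0, 2}, {0, 3}, {1, 2}, {1, 3}, {0, 1, 2, 3}} :
      Finset (Finset (Fin 4))), J = f '' I := by
  classical
  obtain ⟨I, rfl⟩ := Set.subset_range_iff_exists_image_eq.1 hJ
  rw [Set.ncard_image_of_injective _ hf, Set.ncard_eq_toFinset_card'] at heven
  have key : ∀ I : Finset (Fin 4), Even I.card → I ∈ ({∅, {0, 1}, {2, 3}, {0, 2}, {0, 3}, {1, 2},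
    {1, 3}, {0, 1, 2, 3}} : Finset (Finset (Fin 4))) := by decide
  exact ⟨I.toFinset, key _ heven, by rw [Set.coe_toFinset]⟩

variable {V W : Type*} [Finite V] [Finite W] {L Q : SimpleGraph V} {R P : SimpleGraph W}
  {x y r s t u : V} {a b c d : W}

theorem odd_compCard_joined_pair_left (hL : IsDotEdge L x y r s t u) (hxy : IsBoldEdge L x y)
    (hg : IsGadgetPair R a b c d) (hQ : Q ≤ L) (hP : P ≤ R) (hab : ¬ P.Adj a b)
    (hcd : ¬ P.Adj c d)
    (hinl : ∀ v, valency (joined Q P {(r, a), (s, b)}) (.inl v) +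
      2 * delta x v + 2 * delta y v = 2)
    (hinr : ∀ w, valency (joined Q P {(r, a), (s, b)}) (.inr w) = 2) :
    ∀ z ∉ ({.inl x, .inl y} : Set (V ⊕ W)), Odd (compCard (joined Q P {(r, a), (s, b)}) z) := by
  have hrs : r ≠ s := by have := hL.pairwise_ne; grind
  simp only [valency_joined_pair_inl hrs] at hinl
  simp only [valency_joined_pair_inr hrs] at hinr
  rw [joined_pair]
  exact odd_compCard_joined_left hL hxy hg hQ hP hab hcd hinl hinr

theorem odd_compCard_joined_pair_cross (hL : IsDotEdge L x y r s t u) (hxy : IsBoldEdge L x y)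
    (hg : IsGadgetPair R a b c d) (hQ : Q ≤ L) (hP : P ≤ R) (hab : ¬ P.Adj a b)
    (hcd : ¬ P.Adj c d)
    (hinl : ∀ v, valency (joined Q P {(r, a), (t, c)}) (.inl v) +
      2 * delta x v + 2 * delta y v = 2)
    (hinr : ∀ w, valency (joined Q P {(r, a), (t, c)}) (.inr w) = 2) :
    ∀ z ∉ ({.inl x, .inl y} : Set (V ⊕ W)), Odd (compCard (joined Q P {(r, a), (t, c)}) z) := by
  have hrt : r ≠ t := by have := hL.pairwise_ne; grind
  simp only [valency_joined_pair_inl hrt] at hinl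
  simp only [valency_joined_pair_inr hrt] at hinr
  rw [joined_pair]
  exact odd_compCard_joined_cross hL hxy hg hQ hP hab hcd hinl hinr

theorem odd_compCard_joined_quadruple (hL : IsDotEdge L x y r s t u) (hxy : IsBoldEdge L x y)
    (hg : IsGadgetPair R a b c d) (hQ : Q ≤ L) (hP : P ≤ R) (hab : ¬ P.Adj a b)
    (hcd : ¬ P.Adj c d)
    (hinl : ∀ v, valency (joined Q P {(r, a), (s, b), (t, c), (u, d)}) (.inl v) +
      2 * delta x v + 2 * delta y v = 2)
    (hinr : ∀ w, valency (joined Q P {(r, a), (s, b), (t, c), (u, d)}) (.inr w) = 2) :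
    ∀ z ∉ ({.inl x, .inl y} : Set (V ⊕ W)),
      Odd (compCard (joined Q P {(r, a), (s, b), (t, c), (u, d)}) z) := by
  have hnodup : [r, s, t, u].Nodup := by have := hL.pairwise_ne; grind
  simp only [valency_joined_quadruple_inl hnodup] at hinl
  simp only [valency_joined_quadruple_inr hnodup] at hinr
  rw [joined_quadruple]
  exact odd_compCard_joined_both hL hxy hg hQ hP hab hcd hinl hinr

theorem odd_compCard_joined {J : Set (V × W)} (hL : IsDotEdge L x y r s t u)
    (hxy : IsBoldEdge L x y) (hg : IsGadgetPair R a b c d) (hQ : Q ≤ L) (hP : P ≤ R)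
    (hab : ¬ P.Adj a b) (hcd : ¬ P.Adj c d)
    (hJ : J ⊆ {(r, a), (s, b), (t, c), (u, d)}) (heven : Even J.ncard)
    (hinl : ∀ v, valency (joined Q P J) (.inl v) + 2 * delta x v + 2 * delta y v = 2)
    (hinr : ∀ w, valency (joined Q P J) (.inr w) = 2) :
    ∀ z ∉ ({.inl x, .inl y} : Set (V ⊕ W)), Odd (compCard (joined Q P J) z) := by
  have hinj : Function.Injective ![(r, a), (s, b), (t, c), (u, d)] := by
    have := hL.pairwise_ne
    rw [← List.nodup_ofFn]
    simp only [List.ofFn_succ, List.ofFn_zero, Matrix.cons_val_zero, Matrix.cons_val_succ]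
    grind
  have hrange : {(r, a), (s, b), (t, c), (u, d)} ⊆
      Set.range ![(r, a), (s, b), (t, c), (u, d)] := by
    simp only [Matrix.range_cons, Matrix.range_empty]
    grind
  obtain ⟨I, hI, rfl⟩ := exists_image_eq_of_subset_range hinj (hJ.trans hrange) heven
  have hba : ¬ P.Adj b a := fun h => hab h.symm
  have hdc : ¬ P.Adj d c := fun h => hcd h.symm
  have hinl' (v : V) := (add_right_comm _ _ _).trans (hinl v)
  simp only [Finset.mem_insert, Finset.mem_singleton] at hI
  rcases hI with rfl | rfl | rfl | rfl | rfl | rfl | rfl | rfl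
  all_goals simp only [Finset.coe_insert, Finset.coe_singleton, Finset.coe_empty,
    Set.image_insert_eq, Set.image_singleton, Set.image_empty, Matrix.cons_val] at hinl hinl' hinr ⊢
  · simp only [joined_empty, valency_sum_inr] at hinr
    exact absurd ⟨P, ⟨hP, hinr⟩, hab, hcd⟩ hg.not_avoiding
  · exact odd_compCard_joined_pair_left hL hxy hg hQ hP hab hcd hinl hinr
  · rw [Set.pair_comm (Sum.inl x)]
    exact odd_compCard_joined_pair_left hL.symm hxy.symm hg.symm hQ hP hcd hab hinl' hinr
  · exact odd_compCard_joined_pair_cross hL hxy hg hQ hP hab hcd hinl hinr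
  · exact odd_compCard_joined_pair_cross hL.swap_right hxy hg.swap_right hQ hP hab hdc hinl hinr
  · exact odd_compCard_joined_pair_cross hL.swap_left hxy hg.swap_left hQ hP hba hcd hinl hinr
  · exact odd_compCard_joined_pair_cross hL.swap_left.swap_right hxy hg.swap_left.swap_right hQ hP
      hba hdc hinl hinr
  · exact odd_compCard_joined_quadruple hL hxy hg hQ hP hab hcd hinl hinr

end CaseDistinction

section DotProduct

variable {V W : Type*} {L : SimpleGraph V} {R : SimpleGraph W} {x y r s t u : V} {a b c d : W}

/-- The graph `L - {x, y}`, with `x` and `y` kept as isolated vertices. -/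
def deleteEnds (L : SimpleGraph V) (x y : V) : SimpleGraph V :=
  (L.deleteIncidenceSet x).deleteIncidenceSet y

theorem deleteEnds_adj {v w : V} :
    (deleteEnds L x y).Adj v w ↔ L.Adj v w ∧ v ∉ ({x, y} : Set V) ∧ w ∉ ({x, y} : Set V) := by
  simp only [deleteEnds, deleteIncidenceSet_adj]
  grind

theorem deleteEnds_le (L : SimpleGraph V) (x y : V) : deleteEnds L x y ≤ L :=
  fun _ _ h => (deleteEnds_adj.1 h).1

/-- The vertices of the dot product inside the disjoint union of the two vertex sets, which also
contains the deleted vertices `x` and `y`. -/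
def dotInclusion (W : Type*) (x y : V) : ({x, y}ᶜ : Set V) ⊕ W ↪ V ⊕ W :=
  (Function.Embedding.subtype _).sumMap (.refl W)

theorem range_dotInclusion : Set.range (dotInclusion W x y) = {.inl x, .inl y}ᶜ := by
  ext (v | w) <;> simp [dotInclusion]

theorem dotProduct_eq_comap : dotProduct L x y r s t u R a b c d =
    (joined (deleteEnds L x y) (R.deleteEdges {s(a, b), s(c, d)})
      {(r, a), (s, b), (t, c), (u, d)}).comap (dotInclusion W x y) := by
  ext (v | w) (v' | w')
  · simpa [dotProduct, joiningEdges, joined, deleteEnds_adj, dotInclusion] using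
      fun _ => ⟨not_or.1 v.2, not_or.1 v'.2⟩
  all_goals simp [dotProduct, joiningEdges, joined, dotInclusion, -Subtype.exists]

theorem map_dotProduct (hL : IsDotEdge L x y r s t u) :
    (dotProduct L x y r s t u R a b c d).map (dotInclusion W x y) =
      joined (deleteEnds L x y) (R.deleteEdges {s(a, b), s(c, d)})
        {(r, a), (s, b), (t, c), (u, d)} := by
  have := hL.pairwise_ne
  rw [dotProduct_eq_comap, map_comap_eq]
  rintro (v | w) (v' | w') h
  all_goals rw [range_dotInclusion]
  · rw [joined_adj_inl_inl, deleteEnds_adj] at h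
    grind
  · rw [joined_adj_inl_inr] at h
    grind
  all_goals grind

theorem cutSize_joined_range_inl (Q : SimpleGraph V) (P : SimpleGraph W) (J : Set (V × W)) :
    cutSize (joined Q P J) (Set.range .inl) = J.ncard := by
  have hcut : cut (joined Q P J) (Set.range .inl) = Prod.map .inl .inr '' J := by
    ext ⟨v | w, v' | w'⟩ <;> simp [cut, joined_adj_inl_inr]
  rw [cutSize, hcut, Set.ncard_image_of_injective _ (Sum.inl_injective.prodMap Sum.inr_injective)]

theorem even_ncard_of_even_valency_joined [Finite V] [Finite W] {Q : SimpleGraph V}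
    {P : SimpleGraph W} {J : Set (V × W)} (h : ∀ v, Even (valency (joined Q P J) (.inl v))) :
    Even J.ncard := by
  have hsum := even_ncard_odd_valency_add_cutSize (joined Q P J) (Set.range .inl)
  have hempty : {z ∈ Set.range Sum.inl | Odd (valency (joined Q P J) z)} = ∅ := by
    rw [Set.eq_empty_iff_forall_notMem]
    rintro _ ⟨⟨v, rfl⟩, hv⟩
    exact Nat.not_odd_iff_even.2 (h v) hv
  rwa [hempty, Set.ncard_empty, zero_add, cutSize_joined_range_inl] at hsum

theorem valency_map_dotInclusion_inl {G : SimpleGraph (({x, y}ᶜ : Set V) ⊕ W)} {n : ℕ}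
    (hG : ∀ z, valency G z = n) (hxy : x ≠ y) (v : V) :
    valency (G.map (dotInclusion W x y)) (.inl v) + n * delta x v + n * delta y v = n := by
  by_cases hv : (.inl v : V ⊕ W) ∈ Set.range (dotInclusion W x y)
  · obtain ⟨z, hz⟩ := hv
    have hvxy := range_dotInclusion.le ⟨z, hz⟩
    rw [← hz, valency_map, hG]
    grind [delta]
  · rw [valency_map_of_notMem_range hv]
    rw [range_dotInclusion] at hv
    grind [delta]

theorem isOddTwoFactored_dotProduct [Finite V] [Finite W] (hL : IsDotEdge L x y r s t u)
    (hxy : IsBoldEdge L x y) (hg : IsGadgetPair R a b c d) :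
    IsOddTwoFactored (dotProduct L x y r s t u R a b c d) := by
  intro F hF
  have hle := (map_monotone (dotInclusion W x y) hF.1).trans_eq (map_dotProduct hL)
  have hinl := valency_map_dotInclusion_inl hF.2 hxy.adj.ne
  have hinr (w : W) : valency (F.map (dotInclusion W x y)) (.inr w) = 2 :=
    (valency_map (dotInclusion W x y) F (.inr w)).trans (hF.2 (.inr w))
  refine isOdd_of_odd_compCard hF.2 fun z => ?_
  have hz := range_dotInclusion.le ⟨z, rfl⟩
  rw [← compCard_map (dotInclusion W x y)]
  generalize F.map (dotInclusion W x y) = K at hle hinl hinr ⊢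
  set J := {z : V × W | K.Adj (.inl z.1) (.inr z.2)}
  have hK : K = joined (K.comap .inl) (K.comap .inr) J := eq_joined K
  have hleR (w w' : W) (h : K.Adj (.inr w) (.inr w')) :
      R.Adj w w' ∧ s(w, w') ∉ ({s(a, b), s(c, d)} : Set (Sym2 W)) :=
    deleteEdges_adj.1 (joined_adj_inr_inr.1 (hle h))
  rw [hK] at hinl hinr ⊢
  have hval (v : V) : Even (valency (joined (K.comap .inl) (K.comap .inr) J) (.inl v)) := by
    have := hinl v
    grind
  refine odd_compCard_joined hL hxy hg (fun v w h => ?_) (fun v w h => (hleR v w h).1)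
    (fun h => (hleR a b h).2 (.inl rfl)) (fun h => (hleR c d h).2 (.inr rfl)) (fun z h => ?_)
    (even_ncard_of_even_valency_joined hval) hinl hinr _ hz
  · exact deleteEnds_le L x y (joined_adj_inl_inl.1 (hle h))
  · exact joined_adj_inl_inr.1 (hle h)

end DotProduct

section DotProductCuts

open Classical in
theorem crossing_false_right (P : Prop) :
    crossing P False = if P then 1 else 0 := by
  by_cases hP : P <;> simp [crossing, hP]

variable {V W : Type*} {L : SimpleGraph V} {R : SimpleGraph W} {x y r s t u : V} {a b c d : W}

theorem cutSize_deleteEnds_congr {A B : Set V} (h : A \ {x, y} = B \ {x, y}) :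
    cutSize (deleteEnds L x y) A = cutSize (deleteEnds L x y) B := by
  have hcut : cut (deleteEnds L x y) A = cut (deleteEnds L x y) B := by
    ext ⟨v, w⟩
    have hv := Set.ext_iff.1 h v
    have hw := Set.ext_iff.1 h w
    simp only [cut, deleteEnds_adj, Set.mem_ofPred_eq]
    grind
  rw [cutSize, hcut, cutSize]

variable [Finite V] [Finite W]

theorem IsDotEdge.cutSize_sdiff (hL : IsDotEdge L x y r s t u) (A : Set V) :
    cutSize L (A \ {x, y}) = cutSize (deleteEnds L x y) A + crossing (r ∈ A) False +
      crossing (s ∈ A) False + crossing (t ∈ A) False + crossing (u ∈ A) False := by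
  have hne := hL.pairwise_ne
  have hsup : L = deleteEnds L x y ⊔ edge r x ⊔ edge s x ⊔ edge t y ⊔ edge u y ⊔ edge x y := by
    ext v w
    have hx := hL.adj_left_iff
    have hy := hL.adj_right_iff
    simp only [sup_adj, edge_adj, deleteEnds_adj]
    grind [SimpleGraph.Adj.symm]
  have hnotAdj (v w : V) (h : w ∈ ({x, y} : Set V)) : ¬ (deleteEnds L x y).Adj v w :=
    fun hvw => (deleteEnds_adj.1 hvw).2.2 h
  have hx : (x ∈ A \ {x, y}) = False := by simp
  have hy : (y ∈ A \ {x, y}) = False := by simp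
  have hmem (v : V) (hx : v ≠ x) (hy : v ≠ y) : v ∈ A \ {x, y} ↔ v ∈ A := by simp [hx, hy]
  rw [← cutSize_deleteEnds_congr (A := A \ {x, y}) (by simp)]
  conv_lhs => rw [hsup]
  iterate 4 rw [cutSize_sup_edge (by simp only [sup_adj, edge_adj]; grind)]
  rw [cutSize_sup_edge (by grind), hx, hy, hmem r (by grind) (by grind),
    hmem s (by grind) (by grind), hmem t (by grind) (by grind), hmem u (by grind) (by grind)]
  rw [crossing_false_right False, if_neg not_false, add_zero]

theorem cutSize_deleteEdges {G : SimpleGraph V} {p q : V} (h : G.Adj p q) (A : Set V) :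
    cutSize G A = cutSize (G.deleteEdges {s(p, q)}) A + crossing (p ∈ A) (q ∈ A) := by
  rw [← cutSize_sup_edge (by simp)]
  congr 1
  ext v w
  simp only [sup_adj, deleteEdges_adj, edge_adj, Set.mem_singleton_iff, Sym2.eq_iff]
  grind [SimpleGraph.Adj.symm, SimpleGraph.Adj.ne]

theorem IsGadgetPair.cutSize_eq (hg : IsGadgetPair R a b c d) (A : Set W) :
    cutSize R A = cutSize (R.deleteEdges {s(a, b), s(c, d)}) A + crossing (a ∈ A) (b ∈ A) +
      crossing (c ∈ A) (d ∈ A) := by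
  have hcd : (R.deleteEdges {s(a, b)}).Adj c d := by
    have := hg.independent
    simp only [deleteEdges_adj, Set.mem_singleton_iff, Sym2.eq_iff]
    grind [hg.adj_right]
  rw [cutSize_deleteEdges hg.adj_left, cutSize_deleteEdges hcd, deleteEdges_deleteEdges,
    Set.singleton_union, add_right_comm]

theorem cutSize_dotProduct_preimage (hL : IsDotEdge L x y r s t u) (S : Set (V ⊕ W)) :
    cutSize (dotProduct L x y r s t u R a b c d) (dotInclusion W x y ⁻¹' S) =
      cutSize (deleteEnds L x y) (Sum.inl ⁻¹' S) +
      cutSize (R.deleteEdges {s(a, b), s(c, d)}) (Sum.inr ⁻¹' S) +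
      crossing (.inl r ∈ S) (.inr a ∈ S) + crossing (.inl s ∈ S) (.inr b ∈ S) +
      crossing (.inl t ∈ S) (.inr c ∈ S) + crossing (.inl u ∈ S) (.inr d ∈ S) := by
  have hne := hL.pairwise_ne
  rw [← cutSize_map, map_dotProduct hL, joined_quadruple, ← cutSize_sum]
  have hedge (v v' : V) (w w' : W) (h : v ≠ v') :
      ¬ (edge (.inl v') (.inr w') : SimpleGraph (V ⊕ W)).Adj (.inl v) (.inr w) := by
    simp [edge_adj, h]
  iterate 4 rw [cutSize_sup_edge (by simp only [sup_adj, sum_adj, not_or]; grind)]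

theorem valency_dotProduct (hL : IsDotEdge L x y r s t u) (hg : IsGadgetPair R a b c d)
    (hL3 : ∀ v, valency L v = 3) (hR3 : ∀ w, valency R w = 3) (z : ({x, y}ᶜ : Set V) ⊕ W) :
    valency (dotProduct L x y r s t u R a b c d) z = 3 := by
  have hne := hL.pairwise_ne
  have hz := range_dotInclusion.le ⟨z, rfl⟩
  have hnodup := hg.nodup
  rw [← valency_map (dotInclusion W x y), map_dotProduct hL]
  generalize dotInclusion W x y z = z' at hz ⊢
  rcases z' with v | w
  · have hv : v ≠ x ∧ v ≠ y := by
      simpa only [Set.mem_compl_iff, Set.mem_insert_iff, Set.mem_singleton_iff, Sum.inl.injEq,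
        not_or] using hz
    have hdisj : Disjoint {x, y} ({v} : Set V) := by
      rw [Set.disjoint_singleton_right]
      grind
    have h := hL.cutSize_sdiff {v}
    rw [sdiff_eq_self_iff_disjoint.2 hdisj, cutSize_singleton, cutSize_singleton, hL3] at h
    rw [valency_joined_quadruple_inl (by grind), h]
    simp only [crossing_false_right, delta, Set.mem_singleton_iff, eq_comm (b := v)]
  · have h := hg.cutSize_eq {w}
    rw [cutSize_singleton, cutSize_singleton, hR3] at h
    simp only [crossing, Set.mem_singleton_iff] at h
    rw [valency_joined_quadruple_inr (by grind)]
    grind [delta]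

theorem IsDotEdge.two_le_cutSize_deleteEnds (hL : IsDotEdge L x y r s t u)
    (hcuts : HasOnlyTrivialThreeCuts L) (hL3 : ∀ v, valency L v = 3) {A : Set V}
    (hA : (A \ {x, y}).Nonempty) (hA' : (Aᶜ \ {x, y}).Nonempty) :
    2 ≤ cutSize (deleteEnds L x y) A := by
  have hne := hL.pairwise_ne
  have hcut := hL.cutSize_sdiff A
  have hcut' := hL.cutSize_sdiff Aᶜ
  rw [cutSize_compl] at hcut'
  have hthree := hcuts.three_le_cutSize hL3 hA ⟨x, by simp⟩
  have hthree' := hcuts.three_le_cutSize hL3 hA' ⟨x, by simp⟩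
  have hfour {p q : V} (hp : p ∈ A) (hq : q ∈ A) (hpq : p ≠ q) (hp' : p ∉ ({x, y} : Set V))
      (hq' : q ∉ ({x, y} : Set V)) : 4 ≤ cutSize L (A \ {x, y}) :=
    hcuts _ ⟨p, ⟨hp, hp'⟩, q, ⟨hq, hq'⟩, hpq⟩ ⟨x, by simp, y, by simp, hL.adj.ne⟩
  simp only [crossing_false_right, Set.mem_compl_iff] at hcut hcut'
  simp only [Set.mem_insert_iff, Set.mem_singleton_iff] at hfour
  grind

theorem IsGadgetPair.two_le_cutSize_deleteEdges (hg : IsGadgetPair R a b c d)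
    (hcuts : HasOnlyTrivialThreeCuts R) (hR3 : ∀ w, valency R w = 3) {A : Set W}
    (hA : A.Nonempty) (hA' : Aᶜ.Nonempty) :
    2 ≤ cutSize (R.deleteEdges {s(a, b), s(c, d)}) A := by
  have hind := hg.independent
  have hcut := hg.cutSize_eq A
  have hthree := hcuts.three_le_cutSize hR3 hA hA'
  have hfour {p q p' q' : W} (hp : p ∈ A) (hq : q ∈ A) (hpq : p ≠ q) (hp' : p' ∉ A)
      (hq' : q' ∉ A) (hpq' : p' ≠ q') : 4 ≤ cutSize R A :=
    hcuts _ ⟨p, hp, q, hq, hpq⟩ ⟨p', hp', q', hq', hpq'⟩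
  simp only [crossing] at hcut
  grind

theorem IsDotEdge.four_le_cutSize_left (hL : IsDotEdge L x y r s t u)
    (hcuts : HasOnlyTrivialThreeCuts L) {A : Set V} (hA : (A \ {x, y}).Nontrivial) :
    4 ≤ cutSize (deleteEnds L x y) A + crossing (r ∈ A) False + crossing (s ∈ A) False +
      crossing (t ∈ A) False + crossing (u ∈ A) False :=
  (hcuts _ hA ⟨x, by simp, y, by simp, hL.adj.ne⟩).trans_eq (hL.cutSize_sdiff A)

theorem IsGadgetPair.four_le_cutSize_right (hg : IsGadgetPair R a b c d)
    (hcuts : HasOnlyTrivialThreeCuts R) (hR3 : ∀ w, valency R w = 3) {A : Set W}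
    (hA : A.Nontrivial) (hA' : Aᶜ.Nonempty) :
    4 ≤ cutSize (R.deleteEdges {s(a, b), s(c, d)}) A + crossing False (a ∈ A) +
      crossing False (b ∈ A) + crossing False (c ∈ A) + crossing False (d ∈ A) := by
  have hnodup := hg.nodup
  have hcut := hg.cutSize_eq A
  have htwo := hg.two_le_cutSize_deleteEdges hcuts hR3 hA.nonempty hA'
  have hfour {p q : W} (hp : p ∉ A) (hq : q ∉ A) (hpq : p ≠ q) : 4 ≤ cutSize R A :=
    hcuts _ hA ⟨p, hp, q, hq, hpq⟩
  simp only [crossing] at hcut ⊢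
  grind

theorem four_le_cutSize_dotProduct_of_left (hL : IsDotEdge L x y r s t u)
    (hcuts : HasOnlyTrivialThreeCuts L) {A : Set (({x, y}ᶜ : Set V) ⊕ W)} (hA : A.Nontrivial)
    (hright : Sum.inr ⁻¹' A = ∅) : 4 ≤ cutSize (dotProduct L x y r s t u R a b c d) A := by
  obtain ⟨S, rfl⟩ : ∃ S, dotInclusion W x y ⁻¹' S = A :=
    ⟨_, Set.preimage_image_eq A (dotInclusion W x y).injective⟩
  have hnot (w : W) : (.inr w ∈ S) = False :=
    eq_false (Set.eq_empty_iff_forall_notMem.1 hright w)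
  have hS : (Sum.inl ⁻¹' S \ {x, y}).Nontrivial := by
    obtain ⟨p | p, hp, q | q, hq, hpq⟩ := hA
    case inl.inl =>
      exact ⟨p, ⟨hp, p.2⟩, q, ⟨hq, q.2⟩, fun h => hpq (congrArg _ (Subtype.ext h))⟩
    all_goals exact absurd hright (Set.Nonempty.ne_empty ⟨_, by assumption⟩)
  have hfour := hL.four_le_cutSize_left hcuts hS
  rw [cutSize_dotProduct_preimage hL, hnot, hnot, hnot, hnot]
  simp only [Set.mem_preimage] at hfour
  lia

theorem four_le_cutSize_dotProduct_of_right (hL : IsDotEdge L x y r s t u)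
    (hg : IsGadgetPair R a b c d) (hcuts : HasOnlyTrivialThreeCuts R)
    (hR3 : ∀ w, valency R w = 3) {A : Set (({x, y}ᶜ : Set V) ⊕ W)} (hA : A.Nontrivial)
    (hleft : Sum.inl ⁻¹' A = ∅) (hright : (Sum.inr ⁻¹' A)ᶜ.Nonempty) :
    4 ≤ cutSize (dotProduct L x y r s t u R a b c d) A := by
  have hA' : (Sum.inr ⁻¹' A).Nontrivial := by
    obtain ⟨p | p, hp, q | q, hq, hpq⟩ := hA
    case inr.inr => exact ⟨p, hp, q, hq, fun h => hpq (congrArg _ h)⟩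
    all_goals exact absurd hleft (Set.Nonempty.ne_empty ⟨_, by assumption⟩)
  obtain ⟨S, rfl⟩ : ∃ S, dotInclusion W x y ⁻¹' S = A :=
    ⟨_, Set.preimage_image_eq A (dotInclusion W x y).injective⟩
  have hnot (v : V) (hv : v ∉ ({x, y} : Set V)) : (.inl v ∈ S) = False :=
    eq_false (Set.eq_empty_iff_forall_notMem.1 hleft ⟨v, hv⟩)
  have hne := hL.pairwise_ne
  have hfour := hg.four_le_cutSize_right hcuts hR3 (A := Sum.inr ⁻¹' S) hA' hright
  rw [cutSize_dotProduct_preimage hL, hnot r (by grind), hnot s (by grind), hnot t (by grind),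
    hnot u (by grind)]
  simp only [Set.mem_preimage] at hfour
  lia

theorem hasOnlyTrivialThreeCuts_dotProduct (hL : IsDotEdge L x y r s t u)
    (hg : IsGadgetPair R a b c d) (hLcuts : HasOnlyTrivialThreeCuts L)
    (hRcuts : HasOnlyTrivialThreeCuts R) (hL3 : ∀ v, valency L v = 3)
    (hR3 : ∀ w, valency R w = 3) :
    HasOnlyTrivialThreeCuts (dotProduct L x y r s t u R a b c d) := by
  intro A hA hA'
  obtain h₁ | h₁ := (Sum.inr ⁻¹' A).eq_empty_or_nonempty
  · exact four_le_cutSize_dotProduct_of_left hL hLcuts hA h₁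
  obtain h₂ | h₂ := (Sum.inr ⁻¹' Aᶜ).eq_empty_or_nonempty
  · rw [← cutSize_compl]
    exact four_le_cutSize_dotProduct_of_left hL hLcuts hA' h₂
  obtain h₃ | ⟨p, hp⟩ := (Sum.inl ⁻¹' A).eq_empty_or_nonempty
  · exact four_le_cutSize_dotProduct_of_right hL hg hRcuts hR3 hA h₃ h₂
  obtain h₄ | ⟨q, hq⟩ := (Sum.inl ⁻¹' Aᶜ).eq_empty_or_nonempty
  · rw [← cutSize_compl]
    exact four_le_cutSize_dotProduct_of_right hL hg hRcuts hR3 hA' h₄ (by simpa using h₁)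
  have hinj := (dotInclusion W x y).injective
  obtain ⟨S, rfl⟩ : ∃ S, dotInclusion W x y ⁻¹' S = A := ⟨_, Set.preimage_image_eq A hinj⟩
  have hleft := hL.two_le_cutSize_deleteEnds hLcuts hL3 (A := Sum.inl ⁻¹' S)
    ⟨p, hp, p.2⟩ ⟨q, hq, q.2⟩
  have hright := hg.two_le_cutSize_deleteEdges hRcuts hR3 (A := Sum.inr ⁻¹' S) h₁ h₂
  rw [cutSize_dotProduct_preimage hL]
  lia

end DotProductCuts

section DotProductGirth

variable {V W : Type*} {L : SimpleGraph V} {R : SimpleGraph W} {x y r s t u : V} {a b c d : W}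

theorem IsDotEdge.not_adj (hL : IsDotEdge L x y r s t u) (hgirth : 5 ≤ L.egirth) {v w : V}
    (hv : v ∈ ({r, s, t, u} : Set V)) (hw : w ∈ ({r, s, t, u} : Set V)) : ¬ L.Adj v w := by
  have hne := hL.pairwise_ne
  have hend {z : V} (hz : z ∈ ({r, s, t, u} : Set V)) : L.Adj x z ∧ z ≠ y ∨ L.Adj y z ∧ z ≠ x := by
    have hx := hL.adj_left_iff z
    have hy := hL.adj_right_iff z
    grind
  obtain ⟨htriangle, hsquare⟩ := five_le_egirth_iff.1 hgirth
  intro hvw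
  rcases hend hv with ⟨hv, hvy⟩ | ⟨hv, hvx⟩ <;> rcases hend hw with ⟨hw, hwy⟩ | ⟨hw, hwx⟩
  · exact htriangle _ _ _ hv hvw hw.symm
  · exact (hsquare _ _ _ _ hv hvw hw.symm hL.adj.symm).elim hwx.symm hvy
  · exact (hsquare _ _ _ _ hv hvw hw.symm hL.adj).elim hwy.symm hvx
  · exact htriangle _ _ _ hv hvw hw.symm

theorem five_le_egirth_dotProduct (hL : IsDotEdge L x y r s t u) (hg : IsGadgetPair R a b c d)
    (hLgirth : 5 ≤ L.egirth) (hRgirth : 5 ≤ R.egirth) :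
    5 ≤ (dotProduct L x y r s t u R a b c d).egirth := by
  have hne := hL.pairwise_ne
  have hnodup := hg.nodup
  rw [dotProduct_eq_comap]
  refine five_le_egirth_comap _ (five_le_egirth_of_sum ?_ ?_ ?_ ?_ ?_)
  · exact hLgirth.trans (egirth_anti fun v w h => deleteEnds_le L x y (joined_adj_inl_inl.1 h))
  · exact hRgirth.trans (egirth_anti fun v w h => deleteEdges_le _ (joined_adj_inr_inr.1 h))
  · simp only [joined_adj_inl_inr]
    grind
  · simp only [joined_adj_inl_inr]
    grind
  · simp only [joined_adj_inl_inr, joined_adj_inl_inl]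
    intro v v' w w' hv hv' h
    exact hL.not_adj hLgirth (by grind) (by grind) (deleteEnds_le L x y h)

end DotProductGirth

section GreedyColouring

variable {E α : Type*} {H : SimpleGraph E}

/-- The map `c` is a proper vertex colouring of the subgraph of `H` induced on `S`; its values
outside `S` are irrelevant. -/
def IsColoringOn (H : SimpleGraph E) (c : E → α) (S : Set E) : Prop :=
  ∀ p ∈ S, ∀ q ∈ S, H.Adj p q → c p ≠ c q

theorem IsColoringOn.exists_insert [Finite E] {n : ℕ} {c : E → Fin n} {S : Set E} {e : E}
    (hc : IsColoringOn H c S) (he : e ∉ S) (hcard : (c '' (S ∩ H.neighborSet e)).ncard < n) :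
    ∃ c' : E → Fin n, IsColoringOn H c' (insert e S) ∧ Set.EqOn c' c S := by
  classical
  obtain ⟨k, hk⟩ : ∃ k, k ∉ c '' (S ∩ H.neighborSet e) := by
    by_contra! h
    rw [Set.eq_univ_of_forall h, Set.ncard_univ, Nat.card_fin] at hcard
    exact hcard.false
  have heq : Set.EqOn (Function.update c e k) c S := fun p hp =>
    Function.update_of_ne (ne_of_mem_of_not_mem hp he) k c
  have hnew {p : E} (hp : p ∈ S) (hep : H.Adj e p) : Function.update c e k p ≠ k := by
    rw [heq hp]
    exact fun h => hk ⟨p, ⟨hp, hep⟩, h⟩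
  refine ⟨Function.update c e k, ?_, heq⟩
  rintro p (rfl | hp) q (rfl | hq) hpq
  · exact (hpq.ne rfl).elim
  · rw [Function.update_self]
    exact (hnew hq hpq).symm
  · rw [Function.update_self]
    exact hnew hp hpq.symm
  · rw [heq hp, heq hq]
    exact hc p hp q hq hpq

variable [Finite E]

theorem exists_isColoringOn_of_preconnected {n : ℕ} (hdeg : ∀ v, valency H v ≤ n) (hn : 0 < n)
    {e e₁ e₂ : E} (he₁ : e ≠ e₁) (he₂ : e ≠ e₂) (hadj : ¬ H.Adj e₁ e₂)
    (hconn : (H.induce {e₁, e₂}ᶜ).Preconnected) (S : Set E) (heS : e ∉ S) (hS : {e₁, e₂} ⊆ S) :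
    ∃ c : E → Fin n, IsColoringOn H c S ∧ c e₁ = c e₂ := by
  induction S using WellFoundedLT.induction with
  | _ S ih =>
  rcases hS.eq_or_ssubset with rfl | hlt
  · refine ⟨fun _ => ⟨0, hn⟩, ?_, rfl⟩
    rintro p (rfl | rfl) q (rfl | rfl) hpq
    exacts [(hpq.ne rfl).elim, (hadj hpq).elim, (hadj hpq.symm).elim, (hpq.ne rfl).elim]
  obtain ⟨f₀, hf₀S, hf₀⟩ := Set.exists_of_ssubset hlt
  have hereach := hconn ⟨f₀, hf₀⟩ ⟨e, by simp [he₁, he₂]⟩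
  obtain ⟨⟨⟨⟨f, hf'⟩, ⟨g, _⟩⟩, hfg⟩, -, hf, hg⟩ :=
    hereach.some.exists_boundary_dart (Subtype.val ⁻¹' S) hf₀S heS
  obtain ⟨c, hc, hc₁₂⟩ := ih (S \ {f}) (Set.sdiff_singleton_ssubset.2 hf) (fun h => heS h.1)
    (Set.subset_sdiff_singleton hS hf')
  have hcard : (c '' (S \ {f} ∩ H.neighborSet f)).ncard < n := by
    have hsub : S \ {f} ∩ H.neighborSet f ⊂ H.neighborSet f :=
      ⟨Set.inter_subset_right, fun h => hg (h hfg).1.1⟩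
    exact (Set.ncard_image_le (Set.toFinite _)).trans_lt
      ((Set.ncard_lt_ncard hsub (Set.toFinite _)).trans_le (hdeg f))
  obtain ⟨c', hc', heq⟩ := hc.exists_insert (fun h => h.2 rfl) hcard
  rw [Set.insert_sdiff_singleton, Set.insert_eq_of_mem (show f ∈ S from hf)] at hc'
  have hmem := Set.subset_sdiff_singleton hS hf'
  exact ⟨c', hc', by rw [heq (hmem (.inl rfl)), heq (hmem (.inr rfl)), hc₁₂]⟩

-- Lovász's proof of Brooks' theorem: colour greedily towards `e`, starting from `e₁` and `e₂`.
theorem colorable_of_preconnected_induce {n : ℕ} (hdeg : ∀ v, valency H v ≤ n) {e e₁ e₂ : E}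
    (he₁ : H.Adj e e₁) (he₂ : H.Adj e e₂) (hne : e₁ ≠ e₂) (hadj : ¬ H.Adj e₁ e₂)
    (hconn : (H.induce {e₁, e₂}ᶜ).Preconnected) : H.Colorable n := by
  have hlt : ((H.neighborSet e) \ {e₂}).ncard < n :=
    (Set.ncard_sdiff_singleton_lt_of_mem he₂ (Set.toFinite _)).trans_le (hdeg e)
  obtain ⟨c, hc, hc₁₂⟩ := exists_isColoringOn_of_preconnected hdeg (Nat.zero_lt_of_lt hlt) he₁.ne
    he₂.ne hadj hconn {e}ᶜ (fun h => h rfl) (by simp [he₁.ne, he₂.ne])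
  have hcard : (c '' ({e}ᶜ ∩ H.neighborSet e)).ncard < n := by
    have himage : c '' ({e}ᶜ ∩ H.neighborSet e) ⊆ c '' (H.neighborSet e \ {e₂}) := by
      rintro _ ⟨f, ⟨-, hf⟩, rfl⟩
      by_cases hfe : f = e₂
      · exact ⟨e₁, ⟨he₁, hne⟩, by rw [hfe, hc₁₂]⟩
      · exact ⟨f, ⟨hf, hfe⟩, rfl⟩
    exact (Set.ncard_le_ncard himage (Set.toFinite _)).trans_lt
      ((Set.ncard_image_le (Set.toFinite _)).trans_lt hlt)
  obtain ⟨c', hc', -⟩ := hc.exists_insert (fun h => h rfl) hcard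
  rw [Set.insert_eq, Set.union_compl_self] at hc'
  exact ⟨Coloring.mk c' fun {p q} => hc' p trivial q trivial⟩

end GreedyColouring

section LineGraph

variable {V α : Type*} {G : SimpleGraph V}

theorem preconnected_lineGraph (hG : G.Preconnected) : G.lineGraph.Preconnected := by
  have key {v w : V} (p : G.Walk v w) (e f : G.edgeSet) (hv : v ∈ (e : Sym2 V))
      (hw : w ∈ (f : Sym2 V)) : G.lineGraph.Reachable e f := by
    have hreach {v : V} {e f : G.edgeSet} (he : v ∈ (e : Sym2 V)) (hf : v ∈ (f : Sym2 V)) :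
        G.lineGraph.Reachable e f := by
      by_cases hef : e = f
      · rw [hef]
      · exact (lineGraph_adj_iff_exists.2 ⟨hef, v, he, hf⟩).reachable
    induction p generalizing e with
    | nil => exact hreach hv hw
    | @cons v v' w h _ ih =>
      exact (hreach (f := ⟨s(v, v'), h⟩) hv (Sym2.mem_mk_left v v')).trans
        (ih ⟨s(v, v'), h⟩ (Sym2.mem_mk_right v v') hw)
  intro e f
  exact key (hG _ _).some e f (Sym2.out_fst_mem _) (Sym2.out_fst_mem _)

theorem preconnected_induce_lineGraph {S : Set (Sym2 V)} (hG : (G.deleteEdges S).Preconnected) :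
    (G.lineGraph.induce {e : G.edgeSet | (e : Sym2 V) ∉ S}).Preconnected := by
  have hmem (e : (G.deleteEdges S).edgeSet) : (e : Sym2 V) ∈ G.edgeSet ∧ (e : Sym2 V) ∉ S := by
    simpa [edgeSet_deleteEdges] using e.2
  let φ : (G.deleteEdges S).lineGraph →g G.lineGraph.induce {e : G.edgeSet | (e : Sym2 V) ∉ S} :=
    { toFun e := ⟨⟨e, (hmem e).1⟩, (hmem e).2⟩
      map_rel' {e f} h := by
        rw [induce_adj]
        rw [lineGraph_adj_iff_exists] at h ⊢
        exact ⟨fun hef => h.1 (Subtype.ext (Subtype.mk.inj hef)), h.2⟩ }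
  refine (preconnected_lineGraph hG).map φ fun ⟨⟨e, he⟩, heS⟩ => ⟨⟨e, ?_⟩, rfl⟩
  rw [edgeSet_deleteEdges]
  exact ⟨he, heS⟩

theorem valency_lineGraph_add_two_le [Finite V] {p q : V} (h : G.Adj p q) :
    valency G.lineGraph ⟨s(p, q), h⟩ + 2 ≤ valency G p + valency G q := by
  have hsub : Subtype.val '' G.lineGraph.neighborSet ⟨s(p, q), h⟩ ⊆
      (s(p, ·)) '' (G.neighborSet p \ {q}) ∪ (s(q, ·)) '' (G.neighborSet q \ {p}) := by
    rintro _ ⟨⟨f, hf⟩, hadj, rfl⟩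
    obtain ⟨hne, v, hv, hvf⟩ := lineGraph_adj_iff_exists.1 hadj
    obtain ⟨w, rfl⟩ := Sym2.mem_iff_exists.1 hvf
    have hne : s(p, q) ≠ s(v, w) := fun h => hne (Subtype.ext h)
    rcases Sym2.mem_iff.1 hv with rfl | rfl
    · exact .inl ⟨w, ⟨hf, fun hw => hne (by rw [hw])⟩, rfl⟩
    · exact .inr ⟨w, ⟨hf, fun hw => hne (by rw [hw, Sym2.eq_swap])⟩, rfl⟩
  have hle := (Set.ncard_le_ncard hsub (Set.toFinite _)).trans ((Set.ncard_union_le _ _).trans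
    (add_le_add (Set.ncard_image_le (Set.toFinite _)) (Set.ncard_image_le (Set.toFinite _))))
  rw [Set.ncard_image_of_injective _ Subtype.val_injective] at hle
  have hp := Set.ncard_sdiff_singleton_add_one (show q ∈ G.neighborSet p from h)
  have hq := Set.ncard_sdiff_singleton_add_one (show p ∈ G.neighborSet q from h.symm)
  simp only [valency]
  lia

/-- The spanning subgraph of `G` formed by the edges whose colour belongs to `T`. -/
def colorClass (C : G.lineGraph.Coloring α) (T : Set α) : SimpleGraph V where
  Adj v w := ∃ h : G.Adj v w, C ⟨s(v, w), h⟩ ∈ T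
  symm.symm v w := fun ⟨h, hC⟩ => ⟨h.symm, by simpa only [Sym2.eq_swap] using hC⟩
  loopless.irrefl v := fun ⟨h, _⟩ => h.ne rfl

theorem colorClass_le (C : G.lineGraph.Coloring α) (T : Set α) : colorClass C T ≤ G :=
  fun _ _ h => h.1

theorem colorClass_mono (C : G.lineGraph.Coloring α) : Monotone (colorClass C) :=
  fun _ _ hT _ _ ⟨h, hC⟩ => ⟨h, hT hC⟩

theorem valency_colorClass [Finite α] (C : G.lineGraph.Coloring α) {v : V}
    (hv : valency G v = Nat.card α) (T : Set α) : valency (colorClass C T) v = T.ncard := by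
  let color (w : G.neighborSet v) : α := C ⟨s(v, w), w.2⟩
  have hinj : color.Injective := by
    intro w w' h
    by_contra hne
    refine C.valid (lineGraph_adj_iff_exists.2 ⟨fun he => hne (Subtype.ext ?_), v, ?_, ?_⟩) h
    · exact Sym2.congr_right.1 (congrArg Subtype.val he)
    all_goals exact Sym2.mem_mk_left _ _
  have hbij : color.Bijective := (Nat.bijective_iff_injective_and_card color).2 ⟨hinj, hv⟩
  have hset : (colorClass C T).neighborSet v = Subtype.val '' (color ⁻¹' T) := by
    ext w
    simp [colorClass, color]
  rw [valency, hset, Set.ncard_image_of_injective _ Subtype.val_injective,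
    Set.ncard_preimage_of_injective_subset_range hinj fun k _ => hbij.surjective k]

end LineGraph

section CubicEdgeColouring

variable {V : Type*} [Finite V] [Nonempty V] {G : SimpleGraph V}

theorem HasOnlyTrivialThreeCuts.colorable_four_lineGraph (hG : HasOnlyTrivialThreeCuts G)
    (h3 : ∀ v, valency G v = 3) (hgirth : 5 ≤ G.egirth) : G.lineGraph.Colorable 4 := by
  have hother (p q : V) : ∃ z, G.Adj p z ∧ z ≠ q :=
    Set.exists_ne_of_one_lt_ncard (show 1 < valency G p by rw [h3]; norm_num) q
  obtain ⟨p⟩ := ‹Nonempty V›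
  obtain ⟨q, hpq, -⟩ := hother p p
  obtain ⟨p', hpp', hp'q⟩ := hother p q
  obtain ⟨q', hqq', hq'p⟩ := hother q p
  have hp'q' : p' ≠ q' := by
    rintro rfl
    exact (five_le_egirth_iff.1 hgirth).1 _ _ _ hpq hqq' hpp'.symm
  have hne := hpq.ne
  have hdeg (e : G.edgeSet) : valency G.lineGraph e ≤ 4 := by
    obtain ⟨⟨v, w⟩, h⟩ := e
    have := valency_lineGraph_add_two_le h
    rw [h3, h3] at this
    exact Nat.le_of_add_le_add_right this
  have hconn : (G.lineGraph.induce
      ({⟨s(p, p'), hpp'⟩, ⟨s(q, q'), hqq'⟩} : Set G.edgeSet)ᶜ).Preconnected := by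
    have hset : ({⟨s(p, p'), hpp'⟩, ⟨s(q, q'), hqq'⟩} : Set G.edgeSet)ᶜ =
        {e : G.edgeSet | (e : Sym2 V) ∉ ({s(p, p'), s(q, q')} : Set (Sym2 V))} := by
      ext e
      simp [Subtype.ext_iff]
    rw [hset]
    exact preconnected_induce_lineGraph (hG.reachable_deleteEdges h3
      ((Set.ncard_insert_le _ _).trans_eq (by rw [Set.ncard_singleton])))
  refine colorable_of_preconnected_induce hdeg (e := ⟨s(p, q), hpq⟩)
    (lineGraph_adj_iff_exists.2 ⟨?_, p, Sym2.mem_mk_left _ _, Sym2.mem_mk_left _ _⟩)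
    (lineGraph_adj_iff_exists.2 ⟨?_, q, Sym2.mem_mk_right _ _, Sym2.mem_mk_left _ _⟩) ?_ ?_ hconn
  all_goals grind [lineGraph_adj_iff_exists]

theorem IsOddTwoFactored.not_colorable_three_lineGraph (hG : IsOddTwoFactored G)
    (h3 : ∀ v, valency G v = 3) : ¬ G.lineGraph.Colorable 3 := by
  rintro ⟨C⟩
  obtain ⟨v⟩ := ‹Nonempty V›
  have hvalency (T : Set (Fin 3)) (w : V) : valency (colorClass C T) w = T.ncard :=
    valency_colorClass C ((h3 w).trans (Nat.card_fin 3).symm) T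
  have htwo (w : V) : valency (colorClass C {1, 2}) w = 2 :=
    (hvalency _ w).trans (Set.ncard_pair (by decide))
  have hone (w : V) : valency (colorClass C {1}) w = 1 :=
    (hvalency _ w).trans (Set.ncard_singleton _)
  have hodd := (hG _ ⟨colorClass_le C _, htwo⟩).odd_compCard (v := v) fun w _ => htwo w
  have hsub : ({1} : Set (Fin 3)) ⊆ {1, 2} := by simp
  have heven := even_compCard_of_valency_eq_one (colorClass_mono C hsub) hone v
  exact Nat.not_even_iff_odd.2 hodd heven

theorem IsOddTwoFactored.isSnark (hG : IsOddTwoFactored G) (h3 : ∀ v, valency G v = 3)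
    (hcuts : HasOnlyTrivialThreeCuts G) (hgirth : 5 ≤ G.egirth) : IsSnark G where
  connected := hcuts.connected h3
  cubic := h3
  bridgeless e _ := hcuts.not_isBridge h3 e
  cyclically_four_edge_connected := hcuts.isCyclicallyEdgeConnected
  edge_chromatic_number := chromaticNumber_eq_iff_colorable_not_colorable.2
    ⟨hcuts.colorable_four_lineGraph h3 hgirth, hG.not_colorable_three_lineGraph h3⟩
  girth := hgirth

end CubicEdgeColouring

end BoldGadget

theorem theorem3p1 {V W : Type*} [Finite V] [Finite W]
    (L : SimpleGraph V) (R : SimpleGraph W)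
    (hL : BoldGadget.IsSnark L) (hR : BoldGadget.IsSnark R)
    (x y r s t u : V) (a b c d : W)
    (hxy : BoldGadget.IsBoldEdge L x y)
    (hx : L.neighborSet x \ {y} = {r, s}) (hy : L.neighborSet y \ {x} = {t, u})
    (hg : BoldGadget.IsGadgetPair R a b c d) :
    BoldGadget.IsSnark (BoldGadget.dotProduct L x y r s t u R a b c d) ∧
      BoldGadget.IsOddTwoFactored (BoldGadget.dotProduct L x y r s t u R a b c d) := by
  have hdot := hL.isDotEdge hxy.adj hx hy
  have hodd := BoldGadget.isOddTwoFactored_dotProduct hdot hxy hg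
  have hcubic := BoldGadget.valency_dotProduct hdot hg hL.cubic hR.cubic
  have hcuts := BoldGadget.hasOnlyTrivialThreeCuts_dotProduct hdot hg
    hL.hasOnlyTrivialThreeCuts hR.hasOnlyTrivialThreeCuts hL.cubic hR.cubic
  have hgirth := BoldGadget.five_le_egirth_dotProduct hdot hg hL.girth hR.girth
  have : Nonempty (({x, y}ᶜ : Set V) ⊕ W) := ⟨.inr a⟩
  exact ⟨hodd.isSnark hcubic hcuts hgirth, hodd⟩
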